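/- Let $1<p<5$, $0<c<1/4$ and $\omega>0$. Let $H^1_0(\mathbb{R}^+)$ be the closure of $C_c^\infty((0,\infty);\mathbb{C})$ in the $H^1$ norm, and for $u\in H^1_0(\mathbb{R}^+)$ let \[ H(u)=\int_0^\infty\Big(|u'|^2-\frac{c}{x^2}|u|^2\Big)dx,\qquad E(u)=\frac12 H(u)-\frac{1}{p+1}\int_0^\infty|u|^{p+1}dx,\qquad S(u)=E(u)+\frac{\omega}{2}\|u\|_{L^2}^2 . \] Let $\mu$ be the mass of the ground states, that is, \[ \mu=\frac{m}{\omega}\,\frac{p+3}{p-1},\qquad m=\inf\Big\{S(u):u\in H^1_0(\mathbb{R}^+)\setminus\{0\},\ H(u)+\omega\|u\|_{L^2}^2-\int_0^\infty|u|^{p+1}dx=0\Big\}, \] or $\mu=\|u\|_{L^2}^2$ for some ground state $u$, i.e. some $u$ of least action $S$ among the solutions $u\in H^1_0(\mathbb{R}^+)\setminus\{0\}$ of $u''+\frac{c}{x^2}u-\omega u+|u|^{p-1}u=0$, understood in the dual $H^{-1}(\mathbb{R}^+)$ of $H^1_0(\mathbb{R}^+)$. (The conclusions below are asserted for $\mu$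 given by either description.) Put \[ \Gamma=\{u\in H^1_0(\mathbb{R}^+):\|u\|_{L^2}^2=\mu\},\qquad I=\inf\{E(u):u\in\Gamma\}. \] Then: 1. $-\infty<I<0$. 2. The infimum is attained: there is $u\in\Gamma$ with $E(u)=I$. 3. If $(u_n)_{n\in\mathbb{N}}\subset H^1_0(\mathbb{R}^+)$ satisfies $\|u_n\|_{L^2}^2\to\mu$ and $E(u_n)\to I$, then a subsequence of $(u_n)$ converges strongly in $H^1_0(\mathbb{R}^+)$ to some $u\in\Gamma$ with $E(u)=I$. -/

import Mathlib

open MeasureTheory Set Filter Topology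
open scoped ComplexConjugate

noncomputable section

namespace HalfLineNLS

/-- The complex Lebesgue space `L²(ℝ⁺)`, where `ℝ⁺ = (0, ∞)`. -/
abbrev L2 : Type := Lp ℂ 2 (volume.restrict (Ioi (0 : ℝ)))

/-- Complex test functions on `ℝ⁺`: smooth, with compact support contained in `(0, ∞)`. -/
def IsTestFunction (φ : ℝ → ℂ) : Prop :=
  ContDiff ℝ (⊤ : ℕ∞) φ ∧ HasCompactSupport φ ∧ tsupport φ ⊆ Ioi 0

/-- The pairs `(φ, φ')` in `L²(ℝ⁺) × L²(ℝ⁺)`, where `φ` is a test function. The product carries the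
norm `(‖f‖² + ‖g‖²)^(1/2)`, which on such pairs is the `H¹` norm of `φ`. -/
def testGraph : Set (WithLp 2 (L2 × L2)) :=
  {w | ∃ φ : ℝ → ℂ, IsTestFunction φ ∧
    (w.fst : ℝ → ℂ) =ᵐ[volume.restrict (Ioi (0 : ℝ))] φ ∧
    (w.snd : ℝ → ℂ) =ᵐ[volume.restrict (Ioi (0 : ℝ))] deriv φ}

/-- The complex Sobolev space `H¹₀(ℝ⁺)`: the closure of the test functions in the `H¹` norm
`(‖u‖² + ‖u'‖²)^(1/2)`. An element is stored as the pair `(u, u')` of a function and its weak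
derivative. -/
def H10 : Submodule ℂ (WithLp 2 (L2 × L2)) :=
  (Submodule.span ℂ testGraph).topologicalClosure

/-- The function `u` underlying an element of `H¹₀(ℝ⁺)`. -/
def fn (u : H10) : L2 := (u : WithLp 2 (L2 × L2)).fst

/-- The weak derivative `u'` of an element of `H¹₀(ℝ⁺)`. -/
def der (u : H10) : L2 := (u : WithLp 2 (L2 × L2)).snd

/-- `‖u‖²` in `L²(ℝ⁺)`. -/
def mass (u : H10) : ℝ := ‖fn u‖ ^ 2

/-- The Hardy functional `H(u) = ∫₀^∞ (|u'|² - c |u|² / x²) dx`. -/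
def hardy (c : ℝ) (u : H10) : ℝ :=
  ‖der u‖ ^ 2 - c * ∫ x in Ioi (0 : ℝ), ‖fn u x‖ ^ 2 / x ^ 2

/-- The integral `∫₀^∞ |u|^(p+1) dx`. -/
def potential (p : ℝ) (u : H10) : ℝ := ∫ x in Ioi (0 : ℝ), ‖fn u x‖ ^ (p + 1)

/-- The energy `E(u) = ½ ‖u'‖² - (c/2) ‖u/x‖² - (1/(p+1)) ∫ |u|^(p+1)`. -/
def energy (p c : ℝ) (u : H10) : ℝ :=
  1 / 2 * ‖der u‖ ^ 2 - c / 2 * (∫ x in Ioi (0 : ℝ), ‖fn u x‖ ^ 2 / x ^ 2)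
    - 1 / (p + 1) * potential p u

/-- The action `S(u) = ½ H(u) + (ω/2) ‖u‖² - (1/(p+1)) ∫ |u|^(p+1)`. -/
def action (p c ω : ℝ) (u : H10) : ℝ :=
  1 / 2 * hardy c u + ω / 2 * mass u - 1 / (p + 1) * potential p u

/-- The Nehari manifold `{u ≠ 0 : H(u) + ω ‖u‖² - ∫ |u|^(p+1) = 0}`. -/
def nehari (p c ω : ℝ) : Set H10 :=
  {u | u ≠ 0 ∧ hardy c u + ω * mass u - potential p u = 0}

/-- The Nehari level `m`: the infimum of the action on the Nehari manifold. -/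
def nehariLevel (p c ω : ℝ) : ℝ := sInf (action p c ω '' nehari p c ω)

/-- The nonzero solutions `u` in `H¹₀(ℝ⁺)` of `u'' + c u / x² - ω u + |u|^(p-1) u = 0`,
the equation being understood in the dual of `H¹₀(ℝ⁺)`. -/
def boundStates (p c ω : ℝ) : Set H10 :=
  {u | u ≠ 0 ∧ ∀ v : H10,
    -(∫ x in Ioi (0 : ℝ), der u x * conj (der v x))
      + c * (∫ x in Ioi (0 : ℝ), fn u x * conj (fn v x) / (x : ℂ) ^ 2)
      - ω * (∫ x in Ioi (0 : ℝ), fn u x * conj (fn v x))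
      + (∫ x in Ioi (0 : ℝ), ((‖fn u x‖ ^ (p - 1) : ℝ) : ℂ) * fn u x * conj (fn v x)) = 0}

/-- The ground states: the bound states of least action. -/
def groundStates (p c ω : ℝ) : Set H10 :=
  {u | u ∈ boundStates p c ω ∧ ∀ v ∈ boundStates p c ω, action p c ω u ≤ action p c ω v}

/-- `μ` is the mass of the ground states, in either of its two descriptions: the number
`(m / ω) (p + 3) / (p - 1)`, where `m` is the Nehari level, or the squared `L²` norm of some
ground state. -/
def IsGroundStateMass (p c ω μ : ℝ) : Prop :=
  μ = nehariLevel p c ω / ω * ((p + 3) / (p - 1)) ∨ ∃ u ∈ groundStates p c ω, mass u = μ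

/-- The constraint set `Γ = {u ∈ H¹₀(ℝ⁺) : ‖u‖² = μ}`. -/
def sphere (μ : ℝ) : Set H10 := {u | mass u = μ}

/-- The infimum `I` of the energy on `Γ`. -/
def minEnergy (p c μ : ℝ) : ℝ := sInf (energy p c '' sphere μ)

end HalfLineNLS

end

noncomputable section

namespace HalfLineNLS

/-! The enemy of compactness is mass escaping to infinity, where the term `c / x²` is no longer
felt. The least energy of mass `μ` there is `freeLevel p μ`, that of the soliton of the whole line.
The theorem follows from `minEnergy p c μ < freeLevel p μ < 0`; the ground state description of `μ`
enters only through `0 < μ`.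

Compactness (`exists_tendsto_of_minimizing`). Hardy's inequality with `c < 1/4` and
Gagliardo–Nirenberg with `p < 5` bound a minimizing sequence, so it has a weak limit `v`. The mass
and the energy split asymptotically into those of `v` and of the remainder (`tendsto_mass_sub`,
`tendsto_energy_sub`). With `θ = mass v / μ`, scaling gives `E(v) ≥ θ I` (`div_mul_minEnergy_le`),
and the remainder has energy at least `(1 - θ) freeLevel` in the limit
(`WeakTendsto.eventually_le_energy`). Adding, `(1 - θ)(freeLevel - I) ≤ 0`, so `θ = 1`: the
remainder loses its mass, then its potential term, and coercivity gives strong convergence.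

Lower bound at infinity (`exists_le_setIntegral_freeDensity`). The argument is a calibration,
without rearrangement or a discussion of vanishing and dichotomy. If `M` is the maximum of `|u|` on
`[A, ∞)`, take `ω = 2 M^(p-1) / (p+1)`. Then the free energy density plus `ω |u|² / 2` dominates the
modulus of the derivative of `G(|u|)` for an explicit primitive `G`. Going up to the maximum and
down to zero costs `2 G(M) = d ω^α`, apart from a boundary term at `A`. Minimizing `d ω^α - ω μ / 2`
over `ω` gives `freeLevel`, which is negative because `p < 5` means `α > 1`.

Strict inequality (`minEnergy_lt_freeLevel`). The explicit power of `cosh` attains equality in the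
calibration and has energy `freeLevel`. Translated by `R` and cut off, it gains a multiple of
`R^(-2)` from the attractive term, while exponential decay makes the cutoff cost `o(R^(-2))`
(`exists_energy_lt`). -/

/-! ### Continuous representatives of elements of `H¹₀(ℝ⁺)` -/

/-- The primitive `x ↦ ∫₀ˣ f` of a square integrable function on the half-line. -/
def prim (f : L2) (x : ℝ) : ℂ := ∫ t in Ioc 0 x, f t

lemma restrict_Ioi_restrict_Ioc (x : ℝ) :
    (volume.restrict (Ioi (0 : ℝ))).restrict (Ioc 0 x) = volume.restrict (Ioc 0 x) := by
  rw [Measure.restrict_restrict measurableSet_Ioc]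
  congr 1
  exact inter_eq_left.2 fun t ht => ht.1

lemma measure_Ioc_ne_top (x : ℝ) : (volume.restrict (Ioi (0 : ℝ))) (Ioc 0 x) ≠ ⊤ := by
  rw [← Measure.restrict_apply_univ, restrict_Ioi_restrict_Ioc, Measure.restrict_apply_univ]
  simp

/-- Point evaluation of the primitive is a bounded functional of `f`. This gives both the closedness
of `primGraph` and the pointwise convergence of weakly null sequences. -/
lemma prim_eq_inner (f : L2) (x : ℝ) :
    prim f x = inner ℂ (indicatorConstLp 2 measurableSet_Ioc (measure_Ioc_ne_top x) (1 : ℂ)) f := by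
  rw [L2.inner_indicatorConstLp_one, prim, restrict_Ioi_restrict_Ioc]

lemma continuous_prim_left (x : ℝ) : Continuous fun f : L2 => prim f x := by
  simp_rw [prim_eq_inner]
  exact continuous_const.inner continuous_id

lemma prim_add (f g : L2) (x : ℝ) : prim (f + g) x = prim f x + prim g x := by
  simp_rw [prim_eq_inner, inner_add_right]

lemma prim_smul (a : ℂ) (f : L2) (x : ℝ) : prim (a • f) x = a * prim f x := by
  simp_rw [prim_eq_inner, inner_smul_right]

/-- The pairs `(u, u')` for which `u` is the primitive of `u'` vanishing at the origin. -/
def primGraph : Submodule ℂ (WithLp 2 (L2 × L2)) where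
  carrier := {w | (w.fst : ℝ → ℂ) =ᵐ[volume.restrict (Ioi (0 : ℝ))] prim w.snd}
  add_mem' := by
    intro a b ha hb
    simp only [mem_ofPred_eq, WithLp.add_fst, WithLp.add_snd] at *
    filter_upwards [ha, hb, Lp.coeFn_add a.fst b.fst] with x h1 h2 h3
    rw [h3, prim_add, Pi.add_apply, h1, h2]
  zero_mem' := by
    simp only [mem_ofPred_eq, WithLp.zero_fst, WithLp.zero_snd]
    filter_upwards [Lp.coeFn_zero ℂ 2 (volume.restrict (Ioi (0 : ℝ)))] with x h1
    rw [h1, prim_eq_inner, inner_zero_right, Pi.zero_apply]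
  smul_mem' := by
    intro c a ha
    simp only [mem_ofPred_eq, WithLp.smul_fst, WithLp.smul_snd] at *
    filter_upwards [ha, Lp.coeFn_smul c a.fst] with x h1 h2
    rw [h2, prim_smul, Pi.smul_apply, h1, smul_eq_mul]

lemma exists_seq_ae_tendsto {F : ℕ → L2} {f : L2} (h : Tendsto F atTop (𝓝 f)) :
    ∃ k : ℕ → ℕ, StrictMono k ∧ ∀ᵐ x ∂(volume.restrict (Ioi (0 : ℝ))),
      Tendsto (fun n => F (k n) x) atTop (𝓝 (f x)) :=
  (tendstoInMeasure_of_tendsto_Lp h).exists_seq_tendsto_ae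

/-- Convergence in `L²` gives convergence a.e. along a subsequence for the functions, while the
primitives converge at every point. -/
lemma isClosed_primGraph : IsClosed (primGraph : Set (WithLp 2 (L2 × L2))) := by
  apply IsSeqClosed.isClosed
  intro w w0 hw hlim
  have h1 : Tendsto (fun n => (w n).fst) atTop (𝓝 w0.fst) :=
    ((WithLp.fstL 2 ℂ L2 L2).continuous.tendsto w0).comp hlim
  have h2 : Tendsto (fun n => (w n).snd) atTop (𝓝 w0.snd) :=
    ((WithLp.sndL 2 ℂ L2 L2).continuous.tendsto w0).comp hlim
  obtain ⟨k, hk, hk'⟩ := exists_seq_ae_tendsto h1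
  have hae : ∀ᵐ x ∂(volume.restrict (Ioi (0 : ℝ))), ∀ n, (w n).fst x = prim (w n).snd x :=
    ae_all_iff.2 fun n => hw n
  change (w0.fst : ℝ → ℂ) =ᵐ[volume.restrict (Ioi (0 : ℝ))] prim w0.snd
  filter_upwards [hk', hae] with x hx hx'
  refine tendsto_nhds_unique hx ?_
  simp_rw [hx']
  exact (((continuous_prim_left x).tendsto w0.snd).comp h2).comp hk.tendsto_atTop

lemma IsTestFunction.eq_integral_deriv {φ : ℝ → ℂ} (hφ : IsTestFunction φ) {x : ℝ} (hx : 0 ≤ x) :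
    φ x = ∫ t in Ioc 0 x, deriv φ t := by
  have h0 : φ 0 = 0 := by
    by_contra h
    exact lt_irrefl (0 : ℝ) (mem_Ioi.1 (hφ.2.2 (subset_tsupport φ h)))
  have hd : Differentiable ℝ φ := hφ.1.differentiable (by simp)
  rw [← intervalIntegral.integral_of_le hx, intervalIntegral.integral_deriv_eq_sub (fun t _ => hd t)
    ((hφ.1.continuous_deriv (by simp)).intervalIntegrable _ _), h0, sub_zero]

/-- Test functions are primitives of their derivatives, and this relation survives the closure
because its graph is a closed subspace. -/
lemma H10_le_primGraph : H10 ≤ primGraph := by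
  refine Submodule.topologicalClosure_minimal _ (Submodule.span_le.2 ?_) isClosed_primGraph
  rintro w ⟨φ, hφ, h1, h2⟩
  change (w.fst : ℝ → ℂ) =ᵐ[volume.restrict (Ioi (0 : ℝ))] prim w.snd
  filter_upwards [h1, ae_restrict_mem measurableSet_Ioi] with x hx hx0
  rw [hx, hφ.eq_integral_deriv (le_of_lt hx0), prim]
  refine integral_congr_ae ?_
  rw [← restrict_Ioi_restrict_Ioc]
  exact (show deriv φ =ᵐ[volume.restrict (Ioi (0 : ℝ))] (w.snd : ℝ → ℂ) from h2.symm).restrict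

/-- The continuous representative of an element of `H¹₀(ℝ⁺)`. -/
def rep (u : H10) : ℝ → ℂ := prim (der u)

lemma fn_ae_eq_rep (u : H10) : (fn u : ℝ → ℂ) =ᵐ[volume.restrict (Ioi (0 : ℝ))] rep u :=
  H10_le_primGraph u.2

lemma fn_sub (u v : H10) : fn (u - v) = fn u - fn v := rfl
lemma der_sub (u v : H10) : der (u - v) = der u - der v := rfl
lemma fn_smul (a : ℂ) (u : H10) : fn (a • u) = a • fn u := rfl
lemma der_smul (a : ℂ) (u : H10) : der (a • u) = a • der u := rfl

lemma norm_sq_eq (u : H10) : ‖u‖ ^ 2 = mass u + ‖der u‖ ^ 2 := by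
  change ‖(u : WithLp 2 (L2 × L2))‖ ^ 2 = _
  rw [WithLp.prod_norm_sq_eq_of_L2]
  rfl

/-- A test function defines an element of `H¹₀(ℝ⁺)`. -/
lemma IsTestFunction.exists_H10 {φ : ℝ → ℂ} (hφ : IsTestFunction φ) :
    ∃ u : H10, (fn u : ℝ → ℂ) =ᵐ[volume.restrict (Ioi (0 : ℝ))] φ ∧
      (der u : ℝ → ℂ) =ᵐ[volume.restrict (Ioi (0 : ℝ))] deriv φ := by
  have m1 : MemLp φ 2 (volume.restrict (Ioi (0 : ℝ))) :=
    (hφ.1.continuous.memLp_of_hasCompactSupport hφ.2.1)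
  have m2 : MemLp (deriv φ) 2 (volume.restrict (Ioi (0 : ℝ))) :=
    ((hφ.1.continuous_deriv (by simp)).memLp_of_hasCompactSupport hφ.2.1.deriv)
  let w : WithLp 2 (L2 × L2) := WithLp.toLp 2 (m1.toLp φ, m2.toLp (deriv φ))
  have hw : w ∈ testGraph := ⟨φ, hφ, m1.coeFn_toLp, m2.coeFn_toLp⟩
  exact ⟨⟨w, Submodule.le_topologicalClosure _ (Submodule.subset_span hw)⟩,
    m1.coeFn_toLp, m2.coeFn_toLp⟩

lemma integrable_norm_sq (f : L2) :
    Integrable (fun x => ‖f x‖ ^ 2) (volume.restrict (Ioi (0 : ℝ))) :=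
  (Lp.memLp f).integrable_norm_pow (by norm_num)

lemma norm_sq_eq_integral (f : L2) : ‖f‖ ^ 2 = ∫ x in Ioi (0 : ℝ), ‖f x‖ ^ 2 := by
  have h := congrArg Complex.re (L2.inner_def (𝕜 := ℂ) f f)
  rw [inner_self_eq_norm_sq_to_K] at h
  have h2 : (∫ x in Ioi (0 : ℝ), inner ℂ (f x) (f x)) =
      ((∫ x in Ioi (0 : ℝ), ‖f x‖ ^ 2 : ℝ) : ℂ) := by
    rw [← integral_complex_ofReal]
    refine integral_congr_ae (Eventually.of_forall fun x => ?_)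
    simp only [inner_self_eq_norm_sq_to_K]
    norm_cast
  rw [h2] at h
  exact_mod_cast h

lemma integrableOn_Ioc (f : L2) (x : ℝ) : IntegrableOn f (Ioc 0 x) := by
  have h := integrableOn_Lp_of_measure_ne_top f fact_one_le_two_ennreal.elim (measure_Ioc_ne_top x)
  rwa [IntegrableOn, restrict_Ioi_restrict_Ioc] at h

/-! ### Absolute continuity and the chain rule for `|u|` -/

/-- The sums of increments of `f` are squeezed by `K` times those of `N`. It is applied to `|u|`,
controlled by `∫ |u'|`, and then to `G(|u|)`, controlled by `|u|`. -/
lemma absolutelyContinuousOnInterval_of_dist_le {f N : ℝ → ℝ} {a b K : ℝ}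
    (hN : AbsolutelyContinuousOnInterval N a b)
    (h : ∀ x ∈ uIcc a b, ∀ y ∈ uIcc a b, dist (f x) (f y) ≤ K * dist (N x) (N y)) :
    AbsolutelyContinuousOnInterval f a b := by
  have h2 : Tendsto (fun E : ℕ × (ℕ → ℝ × ℝ) =>
      K * ∑ i ∈ Finset.range E.1, dist (N (E.2 i).1) (N (E.2 i).2))
      (AbsolutelyContinuousOnInterval.totalLengthFilter ⊓
        𝓟 (AbsolutelyContinuousOnInterval.disjWithin a b)) (𝓝 0) := by
    simpa using (Tendsto.const_mul K hN)
  refine squeeze_zero' (Eventually.of_forall fun E => Finset.sum_nonneg fun i _ => dist_nonneg)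
    ?_ h2
  refine eventually_inf_principal.2 (Eventually.of_forall fun E hE => ?_)
  rw [Finset.mul_sum]
  exact Finset.sum_le_sum fun i hi => h _ (hE.1 i hi).1 _ (hE.1 i hi).2

lemma prim_sub_prim (f : L2) {a b : ℝ} (ha : 0 ≤ a) (hab : a ≤ b) :
    prim f b - prim f a = ∫ t in Ioc a b, f t := by
  rw [prim, prim, ← Ioc_union_Ioc_eq_Ioc ha hab, setIntegral_union (Ioc_disjoint_Ioc_of_le le_rfl)
    measurableSet_Ioc ((integrableOn_Ioc f b).mono_set (Ioc_subset_Ioc_right hab))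
    ((integrableOn_Ioc f b).mono_set (Ioc_subset_Ioc_left ha)), add_sub_cancel_left]

lemma norm_prim_sub_le (f : L2) {a b : ℝ} (ha : 0 ≤ a) (hab : a ≤ b) :
    ‖prim f b - prim f a‖ ≤ ∫ t in Ioc a b, ‖f t‖ := by
  rw [prim_sub_prim f ha hab]
  exact norm_integral_le_integral_norm _

lemma intervalIntegrable_norm (f : L2) {a b : ℝ} (ha : 0 ≤ a) (hab : a ≤ b) :
    IntervalIntegrable (fun t => ‖f t‖) volume a b := by
  rw [intervalIntegrable_iff_integrableOn_Ioc_of_le hab]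
  exact ((integrableOn_Ioc f b).mono_set (Ioc_subset_Ioc_left ha)).norm

lemma abs_norm_prim_sub_le (f : L2) {a b x y : ℝ} (ha : 0 ≤ a) (hx : x ∈ Icc a b)
    (hy : y ∈ Icc a b) :
    |‖prim f x‖ - ‖prim f y‖| ≤ |(∫ t in a..x, ‖f t‖) - ∫ t in a..y, ‖f t‖| := by
  wlog hxy : y ≤ x generalizing x y
  · rw [abs_sub_comm, abs_sub_comm (∫ t in a..x, ‖f t‖)]
    exact this hy hx (le_of_not_ge hxy)
  rw [intervalIntegral.integral_interval_sub_left (intervalIntegrable_norm f ha hx.1)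
    (intervalIntegrable_norm f ha hy.1), intervalIntegral.integral_of_le hxy]
  exact (abs_norm_sub_norm_le _ _).trans ((norm_prim_sub_le f (ha.trans hy.1) hxy).trans
    (le_abs_self _))

lemma continuousOn_prim (f : L2) : ContinuousOn (prim f) (Ici 0) := by
  intro x hx
  have h1 : ContinuousOn (fun y => ∫ t in (0 : ℝ)..y, f t) (uIcc 0 (x + 1)) :=
    intervalIntegral.continuousOn_primitive_interval' (by
      rw [intervalIntegrable_iff_integrableOn_Ioc_of_le (by linarith [mem_Ici.1 hx])]
      exact integrableOn_Ioc f _) (by simp)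
  have hx0 : (0 : ℝ) ≤ x := hx
  rw [uIcc_of_le (by linarith)] at h1
  have h2 := h1 x ⟨hx0, by linarith⟩
  have h3 : ContinuousWithinAt (fun y => ∫ t in (0 : ℝ)..y, f t) (Ici 0) x := by
    refine h2.mono_of_mem_nhdsWithin ?_
    have : Iio (x + 1) ∈ 𝓝 x := Iio_mem_nhds (by linarith)
    filter_upwards [self_mem_nhdsWithin, mem_nhdsWithin_of_mem_nhds this] with y hy hy2
    exact ⟨hy, le_of_lt hy2⟩
  refine h3.congr (fun y hy => ?_) ?_
  · rw [intervalIntegral.integral_of_le hy]; rfl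
  · rw [intervalIntegral.integral_of_le hx0]; rfl

lemma abs_deriv_le_of_dist_le {r N : ℝ → ℝ} {r' N' x : ℝ} (hr : HasDerivAt r r' x)
    (hN : HasDerivAt N N' x) (h : ∀ᶠ y in 𝓝 x, |r y - r x| ≤ |N y - N x|) : |r'| ≤ |N'| := by
  have h1 := (hasDerivAt_iff_tendsto_slope.1 hr).abs
  have h2 := (hasDerivAt_iff_tendsto_slope.1 hN).abs
  refine le_of_tendsto_of_tendsto h1 h2 ?_
  filter_upwards [h.filter_mono nhdsWithin_le_nhds] with y hy
  simp only [slope_def_field, abs_div]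
  exact div_le_div_of_nonneg_right hy (abs_nonneg _)

/-- Fundamental theorem of calculus for `G ∘ ‖u‖`, as an estimate. -/
lemma abs_comp_norm_prim_sub_le (f : L2) {G G' : ℝ → ℝ} (hG : ∀ s, HasDerivAt G (G' s) s)
    (hc : Continuous G') {a b : ℝ} (ha : 0 ≤ a) (hab : a ≤ b) :
    |G ‖prim f b‖ - G ‖prim f a‖| ≤ ∫ t in Ioc a b, |G' ‖prim f t‖| * ‖f t‖ := by
  set N : ℝ → ℝ := fun x => ∫ t in a..x, ‖f t‖ with hN
  set r : ℝ → ℝ := fun x => ‖prim f x‖ with hr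
  have hI := intervalIntegrable_norm f ha hab
  have hNac : AbsolutelyContinuousOnInterval N a b :=
    hI.absolutelyContinuousOnInterval_intervalIntegral (by simp)
  have hrc : ContinuousOn r (Icc a b) :=
    (continuousOn_prim f).norm.mono fun x hx => ha.trans hx.1
  have hrac : AbsolutelyContinuousOnInterval r a b := by
    refine absolutelyContinuousOnInterval_of_dist_le (K := 1) hNac fun x hx y hy => ?_
    rw [uIcc_of_le hab] at hx hy
    rw [one_mul, Real.dist_eq, Real.dist_eq]
    exact abs_norm_prim_sub_le f ha hx hy
  -- On the compact range `[-B, B]` of `|u|` the function `G` is Lipschitz with constant `L`; no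
  -- global bound on `G'` is needed.
  obtain ⟨B, hB⟩ := isCompact_Icc.exists_bound_of_continuousOn hrc
  obtain ⟨L, hL⟩ := (isCompact_Icc (a := -B) (b := B)).exists_bound_of_continuousOn
    hc.continuousOn
  have hmem : ∀ x ∈ Icc a b, r x ∈ Icc (-B) B := fun x hx => abs_le.1 (hB x hx)
  have hfac : AbsolutelyContinuousOnInterval (fun x => G (r x)) a b := by
    refine absolutelyContinuousOnInterval_of_dist_le (K := L) hrac fun x hx y hy => ?_
    rw [uIcc_of_le hab] at hx hy
    rw [dist_eq_norm, dist_eq_norm]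
    exact (convex_Icc (-B) B).norm_image_sub_le_of_norm_hasDerivWithin_le
      (fun s _ => (hG s).hasDerivWithinAt) (fun s hs => hL s hs) (hmem y hy) (hmem x hx)
  have hbd : ∀ᵐ x, x ∈ Ioc a b → ‖deriv (fun x => G (r x)) x‖ ≤ |G' (r x)| * ‖f x‖ := by
    have h1 := hrac.ae_differentiableAt
    have h2 := hI.ae_hasDerivAt_integral
    -- The endpoint is discarded so that `[a, b]` is a neighbourhood of `x` when increments are
    -- compared.
    have h3 : ∀ᵐ x : ℝ, x ≠ b := by simp [ae_iff, measure_singleton]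
    filter_upwards [h1, h2, h3] with x h1 h2 h3 hx
    rw [uIcc_of_le hab] at h1 h2
    have hx' : x ∈ Icc a b := ⟨hx.1.le, hx.2⟩
    have hd := (h1 hx').hasDerivAt
    have hd2 : HasDerivAt N ‖f x‖ x := h2 hx' a (left_mem_Icc.2 hab)
    have hle : |deriv r x| ≤ |‖f x‖| := by
      refine abs_deriv_le_of_dist_le hd hd2 ?_
      filter_upwards [Icc_mem_nhds hx.1 (lt_of_le_of_ne hx.2 h3)] with y hy
      exact abs_norm_prim_sub_le f ha hy hx'
    rw [show deriv (fun x => G (r x)) x = G' (r x) * deriv r x from ((hG (r x)).comp x hd).deriv,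
      norm_mul, Real.norm_eq_abs, Real.norm_eq_abs]
    rw [abs_norm] at hle
    gcongr
  have hint : IntegrableOn (fun t => |G' (r t)| * ‖f t‖) (Ioc a b) := by
    have h4 := (intervalIntegrable_iff_integrableOn_Ioc_of_le hab).1
      (hI.continuousOn_mul (g := fun t => |G' (r t)|)
        (by rw [uIcc_of_le hab]; exact (hc.comp_continuousOn hrc).abs))
    exact h4
  rw [← hfac.integral_deriv_eq_sub, intervalIntegral.integral_of_le hab]
  refine (norm_integral_le_integral_norm (deriv fun x => G (r x))).trans ?_
  refine integral_mono_ae ((intervalIntegrable_iff_integrableOn_Ioc_of_le hab).1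
    hfac.intervalIntegrable_deriv).norm hint ?_
  exact (ae_restrict_iff' measurableSet_Ioc).2 hbd

/-! ### Sup bound and decay at infinity -/

lemma integrable_norm_mul_norm (f g : L2) :
    Integrable (fun x => ‖f x‖ * ‖g x‖) (volume.restrict (Ioi (0 : ℝ))) :=
  (Lp.memLp f).norm.integrable_mul (Lp.memLp g).norm

lemma integral_norm_mul_norm_le (f g : L2) :
    ∫ x in Ioi (0 : ℝ), ‖f x‖ * ‖g x‖ ≤ ‖f‖ * ‖g‖ := by
  have h := integral_mul_le_Lp_mul_Lq_of_nonneg (μ := volume.restrict (Ioi (0 : ℝ)))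
    Real.HolderConjugate.two_two (f := fun x => ‖f x‖) (g := fun x => ‖g x‖)
    (Eventually.of_forall fun x => norm_nonneg _) (Eventually.of_forall fun x => norm_nonneg _)
    (by simpa using (Lp.memLp f).norm) (by simpa using (Lp.memLp g).norm)
  simp only [Real.rpow_ofNat] at h
  rwa [← norm_sq_eq_integral, ← norm_sq_eq_integral, ← Real.sqrt_eq_rpow, ← Real.sqrt_eq_rpow,
    Real.sqrt_sq (norm_nonneg _), Real.sqrt_sq (norm_nonneg _)] at h

/-- Otherwise `|u|²` would exceed `ε` on a half-line, which has infinite measure, contradicting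
integrability. -/
lemma exists_norm_rep_sq_le (u : H10) (x : ℝ) {ε : ℝ} (hε : 0 < ε) :
    ∃ y, x ≤ y ∧ 0 ≤ y ∧ ‖rep u y‖ ^ 2 ≤ ε := by
  by_contra! h
  have h1 : IntegrableOn (fun y => ‖fn u y‖ ^ 2) (Ioi (max x 0)) :=
    (integrable_norm_sq (fn u)).mono_measure
      (Measure.restrict_mono (Ioi_subset_Ioi (le_max_right x 0)) le_rfl)
  have h2 : IntegrableOn (fun _ : ℝ => ε) (Ioi (max x 0)) := by
    refine h1.mono' aestronglyMeasurable_const ?_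
    have h3 := ae_mono (Measure.restrict_mono (Ioi_subset_Ioi (le_max_right x 0)) le_rfl)
      (fn_ae_eq_rep u)
    filter_upwards [h3, ae_restrict_mem measurableSet_Ioi] with y hy hy'
    rw [hy, Real.norm_of_nonneg hε.le]
    exact (h y ((le_max_left _ _).trans (le_of_lt hy'))
      ((le_max_right _ _).trans (le_of_lt hy'))).le
  rw [integrableOn_const_iff] at h2
  simp [hε.ne'] at h2

lemma ae_restrict_Ioc_of_ae {P : ℝ → Prop} (h : ∀ᵐ x ∂(volume.restrict (Ioi (0 : ℝ))), P x)
    {a b : ℝ} (ha : 0 ≤ a) : ∀ᵐ x ∂(volume.restrict (Ioc a b)), P x :=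
  ae_mono (Measure.restrict_mono (fun _ ht => lt_of_le_of_lt ha ht.1) le_rfl) h

/-- The estimate for `G(s) = s²` is applied between `x` and a far point where `|u|² ≤ ε`, and then
`ε → 0`. The integral over a tail yields decay; enlarged to `(0, ∞)` it yields the sup bound. -/
lemma norm_rep_sq_le_tail (u : H10) {x : ℝ} (hx : 0 ≤ x) :
    ‖rep u x‖ ^ 2 ≤ ∫ t in Ioi x, 2 * (‖fn u t‖ * ‖der u t‖) := by
  refine le_of_forall_pos_le_add fun ε hε => ?_
  obtain ⟨y, hxy, hy0, hy⟩ := exists_norm_rep_sq_le u x hε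
  have h1 := abs_comp_norm_prim_sub_le (der u) (G := fun s => s ^ 2) (G' := fun s => 2 * s)
    (fun s => by simpa using hasDerivAt_pow 2 s) (by fun_prop) hx hxy
  have h2 : ∫ t in Ioc x y, |2 * ‖prim (der u) t‖| * ‖der u t‖ =
      ∫ t in Ioc x y, 2 * (‖fn u t‖ * ‖der u t‖) := by
    refine integral_congr_ae ?_
    filter_upwards [ae_restrict_Ioc_of_ae (fn_ae_eq_rep u) hx] with t ht
    rw [ht, abs_of_nonneg (by positivity), rep, mul_assoc]
  have h3 : ∫ t in Ioc x y, 2 * (‖fn u t‖ * ‖der u t‖) ≤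
      ∫ t in Ioi x, 2 * (‖fn u t‖ * ‖der u t‖) := by
    refine setIntegral_mono_set ?_ (Eventually.of_forall fun t => by positivity)
      (Eventually.of_forall Ioc_subset_Ioi_self)
    exact ((integrable_norm_mul_norm (fn u) (der u)).mono_measure
      (Measure.restrict_mono (Ioi_subset_Ioi hx) le_rfl)).const_mul 2
  have h4 := neg_abs_le (‖prim (der u) y‖ ^ 2 - ‖prim (der u) x‖ ^ 2)
  simp only [rep] at hy ⊢
  linarith

lemma norm_rep_sq_le (u : H10) {x : ℝ} (hx : 0 ≤ x) :
    ‖rep u x‖ ^ 2 ≤ 2 * (‖fn u‖ * ‖der u‖) := by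
  refine (norm_rep_sq_le_tail u hx).trans ?_
  rw [integral_const_mul]
  refine mul_le_mul_of_nonneg_left (le_trans ?_ (integral_norm_mul_norm_le _ _)) zero_le_two
  exact setIntegral_mono_set (integrable_norm_mul_norm (fn u) (der u))
    (Eventually.of_forall fun t => by positivity)
    (Eventually.of_forall (Ioi_subset_Ioi hx))

lemma tendsto_setIntegral_Ioi_zero {h : ℝ → ℝ} {a : ℝ} (hh : IntegrableOn h (Ioi a)) :
    Tendsto (fun x => ∫ t in Ioi x, h t) atTop (𝓝 0) := by
  have h1 := (intervalIntegral_tendsto_integral_Ioi a hh tendsto_id).const_sub (∫ t in Ioi a, h t)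
  rw [sub_self] at h1
  refine h1.congr' ?_
  filter_upwards [eventually_ge_atTop a] with x hx
  rw [id, intervalIntegral.integral_of_le hx, ← Ioc_union_Ioi_eq_Ioi hx, setIntegral_union
    (Ioc_disjoint_Ioi le_rfl) measurableSet_Ioi (hh.mono_set Ioc_subset_Ioi_self)
    (hh.mono_set (Ioi_subset_Ioi hx)), add_sub_cancel_left]

lemma tendsto_norm_rep (u : H10) : Tendsto (fun x => ‖rep u x‖) atTop (𝓝 0) := by
  have h1 : Tendsto (fun x => ‖rep u x‖ ^ 2) atTop (𝓝 0) :=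
    tendsto_of_tendsto_of_tendsto_of_le_of_le' tendsto_const_nhds
      (tendsto_setIntegral_Ioi_zero ((integrable_norm_mul_norm (fn u) (der u)).const_mul 2))
      (Eventually.of_forall fun x => by positivity)
      ((eventually_ge_atTop 0).mono fun x hx => norm_rep_sq_le_tail u hx)
  have h2 := h1.sqrt
  simpa [Real.sqrt_sq (norm_nonneg _)] using h2

/-! ### Hardy's inequality -/

lemma lintegral_Ioc_rpow_neg_half (x : ℝ) (hx : 0 < x) :
    ∫⁻ s in Ioc 0 x, ENNReal.ofReal (s ^ (-(1 / 2) : ℝ)) = ENNReal.ofReal (2 * x ^ (1 / 2 : ℝ)) := by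
  have hi : IntegrableOn (fun s : ℝ => s ^ (-(1 / 2) : ℝ)) (Ioc 0 x) :=
    (intervalIntegrable_iff_integrableOn_Ioc_of_le hx.le).1
      (intervalIntegral.intervalIntegrable_rpow' (by norm_num))
  rw [← ofReal_integral_eq_lintegral_ofReal hi
    ((ae_restrict_mem measurableSet_Ioc).mono fun s hs => Real.rpow_nonneg hs.1.le _),
    ← intervalIntegral.integral_of_le hx.le, integral_rpow (Or.inl (by norm_num))]
  congr 1
  norm_num
  ring

lemma lintegral_Ioi_rpow_neg_three_halves (s : ℝ) (hs : 0 < s) :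
    ∫⁻ x in Ioi s, ENNReal.ofReal (x ^ (-(3 / 2) : ℝ)) =
      ENNReal.ofReal (2 * s ^ (-(1 / 2) : ℝ)) := by
  rw [← ofReal_integral_eq_lintegral_ofReal (integrableOn_Ioi_rpow_of_lt (by norm_num) hs)
    ((ae_restrict_mem measurableSet_Ioi).mono fun x hx => Real.rpow_nonneg (hs.trans hx).le _),
    integral_Ioi_rpow_of_lt (by norm_num) hs]
  congr 1
  norm_num
  ring

/-- Cauchy–Schwarz after writing `|f| = (|f| s^(1/4)) s^(-1/4)`. This weight leads to the sharp
Hardy constant: it produces one factor `2` here and another after the interchange of integrals. -/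
lemma enorm_prim_sq_le (f : L2) {x : ℝ} (hx : 0 < x) :
    ‖prim f x‖ₑ ^ 2 ≤ ENNReal.ofReal (2 * x ^ (1 / 2 : ℝ)) *
      ∫⁻ s in Ioc 0 x, ‖f s‖ₑ ^ 2 * ENNReal.ofReal (s ^ (1 / 2 : ℝ)) := by
  have hm : Measurable f := (Lp.stronglyMeasurable f).measurable
  have h1 : ‖prim f x‖ₑ ≤ ∫⁻ s in Ioc 0 x, (fun s => ‖f s‖ₑ * ENNReal.ofReal (s ^ (1 / 4 : ℝ)))
      s * (fun s => ENNReal.ofReal (s ^ (-(1 / 4) : ℝ))) s := by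
    refine (enorm_integral_le_lintegral_enorm _).trans (le_of_eq ?_)
    refine setLIntegral_congr_fun measurableSet_Ioc fun s hs => ?_
    simp only
    rw [mul_assoc, ← ENNReal.ofReal_mul (Real.rpow_nonneg hs.1.le _), ← Real.rpow_add hs.1]
    simp
  have h2 := ENNReal.lintegral_mul_le_Lp_mul_Lq (volume.restrict (Ioc 0 x))
    Real.HolderConjugate.two_two
    (f := fun s => ‖f s‖ₑ * ENNReal.ofReal (s ^ (1 / 4 : ℝ)))
    (g := fun s => ENNReal.ofReal (s ^ (-(1 / 4) : ℝ)))
    (by fun_prop) (by fun_prop)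
  have h3 := ENNReal.rpow_le_rpow (h1.trans h2) (z := 2) (by norm_num)
  rw [ENNReal.mul_rpow_of_nonneg _ _ (by norm_num), ← ENNReal.rpow_mul, ← ENNReal.rpow_mul] at h3
  norm_num at h3
  rw [mul_comm]
  refine h3.trans (le_of_eq ?_)
  congr 1
  · refine setLIntegral_congr_fun measurableSet_Ioc fun s hs => ?_
    rw [mul_pow, ← ENNReal.ofReal_pow (Real.rpow_nonneg hs.1.le _), ← Real.rpow_mul_natCast hs.1.le]
    norm_num
  · have h5 := lintegral_Ioc_rpow_neg_half x hx
    norm_num at h5 ⊢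
    rw [← h5]
    refine setLIntegral_congr_fun measurableSet_Ioc fun s hs => ?_
    rw [← ENNReal.ofReal_pow (Real.rpow_nonneg hs.1.le _), ← Real.rpow_mul_natCast hs.1.le]
    norm_num

/-- Tonelli's theorem after the weighted Cauchy–Schwarz bound. Since `T` contains `(0, x]` with each
of its points `x`, the derivative is only needed on `T`. The constant `4` is therefore also
available on `(0, A]`, where it absorbs the attractive term near the origin. -/
lemma lintegral_hardy_le (f : L2) {T : Set ℝ} (hT : MeasurableSet T) (hT0 : T ⊆ Ioi 0)
    (hT' : ∀ x ∈ T, Ioc 0 x ⊆ T) :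
    ∫⁻ x in T, ‖prim f x‖ₑ ^ 2 * ENNReal.ofReal (x ^ (-2 : ℝ)) ≤ 4 * ∫⁻ s in T, ‖f s‖ₑ ^ 2 := by
  have hm : Measurable f := (Lp.stronglyMeasurable f).measurable
  set w : ℝ → ENNReal := fun s => ‖f s‖ₑ ^ 2 * ENNReal.ofReal (s ^ (1 / 2 : ℝ)) with hw
  have hwm : Measurable w := by fun_prop
  have h1 : ∫⁻ x in T, ‖prim f x‖ₑ ^ 2 * ENNReal.ofReal (x ^ (-2 : ℝ)) ≤
      ∫⁻ x in T, ∫⁻ s in T, (Iic x).indicator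
        (fun s => ENNReal.ofReal (2 * x ^ (-(3 / 2) : ℝ)) * w s) s := by
    refine setLIntegral_mono' hT fun x hx => ?_
    have hx0 : (0 : ℝ) < x := hT0 hx
    have h2 : ∫⁻ s in T, (Iic x).indicator
        (fun s => ENNReal.ofReal (2 * x ^ (-(3 / 2) : ℝ)) * w s) s =
        ENNReal.ofReal (2 * x ^ (-(3 / 2) : ℝ)) * ∫⁻ s in Ioc 0 x, w s := by
      rw [lintegral_indicator measurableSet_Iic, Measure.restrict_restrict measurableSet_Iic,
        lintegral_const_mul _ hwm]
      congr 3
      ext s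
      exact ⟨fun h => ⟨hT0 h.2, h.1⟩, fun h => ⟨h.2, hT' x hx h⟩⟩
    rw [h2]
    refine (mul_le_mul_left (enorm_prim_sq_le f hx0) _).trans (le_of_eq ?_)
    rw [mul_right_comm, ← ENNReal.ofReal_mul (by positivity), mul_assoc 2, ← Real.rpow_add hx0,
      show (-(3 / 2) : ℝ) = 1 / 2 + -2 by norm_num]
  have hmeas : Measurable (Function.uncurry fun x s : ℝ => (Iic x).indicator
      (fun s => ENNReal.ofReal (2 * x ^ (-(3 / 2) : ℝ)) * w s) s) := by
    have : (Function.uncurry fun x s : ℝ => (Iic x).indicator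
        (fun s => ENNReal.ofReal (2 * x ^ (-(3 / 2) : ℝ)) * w s) s) =
        {q : ℝ × ℝ | q.2 ≤ q.1}.indicator
          fun q => ENNReal.ofReal (2 * q.1 ^ (-(3 / 2) : ℝ)) * w q.2 := by
      ext ⟨x, s⟩
      simp [indicator]
    rw [this]
    exact Measurable.indicator (by fun_prop) (measurableSet_le measurable_snd measurable_fst)
  refine h1.trans ?_
  rw [lintegral_lintegral_swap hmeas.aemeasurable, ← lintegral_const_mul _ (by fun_prop)]
  refine setLIntegral_mono' hT fun s hs => ?_
  have hs0 : (0 : ℝ) < s := hT0 hs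
  calc ∫⁻ x in T, (Iic x).indicator (fun s => ENNReal.ofReal (2 * x ^ (-(3 / 2) : ℝ)) * w s) s
      ≤ ∫⁻ x, (Ici s).indicator (fun x => w s * (2 * ENNReal.ofReal (x ^ (-(3 / 2) : ℝ)))) x := by
        refine (lintegral_mono fun x => ?_).trans (setLIntegral_le_lintegral T _)
        by_cases h : s ≤ x
        · rw [indicator_of_mem (show s ∈ Iic x from h), indicator_of_mem (show x ∈ Ici s from h),
            mul_comm, ENNReal.ofReal_mul zero_le_two]
          norm_num
        · rw [indicator_of_notMem (show s ∉ Iic x from h)]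
          exact zero_le
    _ = w s * (2 * ∫⁻ x in Ioi s, ENNReal.ofReal (x ^ (-(3 / 2) : ℝ))) := by
        rw [lintegral_indicator measurableSet_Ici, lintegral_const_mul _ (by fun_prop),
          lintegral_const_mul _ (by fun_prop), setLIntegral_congr Ioi_ae_eq_Ici.symm]
    _ ≤ 4 * ‖f s‖ₑ ^ 2 := by
        rw [lintegral_Ioi_rpow_neg_three_halves s hs0, hw]
        simp only
        rw [mul_assoc, show ∀ y : ENNReal, 2 * y = ENNReal.ofReal 2 * y by norm_num,
          ← ENNReal.ofReal_mul zero_le_two, ← ENNReal.ofReal_mul (by positivity),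
          show s ^ (1 / 2 : ℝ) * (2 * (2 * s ^ (-(1 / 2) : ℝ))) = 4 from ?_, mul_comm]
        · norm_num
        · have : s ^ (1 / 2 : ℝ) * s ^ (-(1 / 2) : ℝ) = 1 := by
            rw [← Real.rpow_add hs0]; norm_num
          linear_combination 4 * this

lemma integrableOn_hardy (f : L2) {T : Set ℝ} (hT : MeasurableSet T) (hT0 : T ⊆ Ioi 0)
    (hT' : ∀ x ∈ T, Ioc 0 x ⊆ T) :
    IntegrableOn (fun x => ‖prim f x‖ ^ 2 / x ^ 2) T ∧
      ∫ x in T, ‖prim f x‖ ^ 2 / x ^ 2 ≤ 4 * ∫ x in T, ‖f x‖ ^ 2 := by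
  have h1 := lintegral_hardy_le f hT hT0 hT'
  have hcont : ContinuousOn (fun x => ‖prim f x‖ ^ 2 / x ^ 2) T := by
    refine ContinuousOn.div (((continuousOn_prim f).mono fun x hx => le_of_lt (mem_Ioi.1 (hT0 hx))).norm.pow 2)
      (by fun_prop) fun x hx => (pow_pos (hT0 hx) 2).ne'
  have h2 : ∫⁻ x in T, ‖prim f x‖ₑ ^ 2 * ENNReal.ofReal (x ^ (-2 : ℝ)) =
      ∫⁻ x in T, ENNReal.ofReal (‖prim f x‖ ^ 2 / x ^ 2) := by
    refine setLIntegral_congr_fun hT fun x hx => ?_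
    rw [← ofReal_norm, ← ENNReal.ofReal_pow (norm_nonneg _),
      ← ENNReal.ofReal_mul (by positivity), Real.rpow_neg (le_of_lt (hT0 hx))]
    norm_num [div_eq_mul_inv]
  have hi2 : IntegrableOn (fun x => ‖f x‖ ^ 2) T :=
    (integrable_norm_sq f).mono_measure (Measure.restrict_mono hT0 le_rfl)
  have h3 : ∫⁻ s in T, ‖f s‖ₑ ^ 2 = ENNReal.ofReal (∫ x in T, ‖f x‖ ^ 2) := by
    rw [ofReal_integral_eq_lintegral_ofReal hi2 (Eventually.of_forall fun x => by positivity)]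
    refine lintegral_congr fun x => ?_
    rw [← ofReal_norm, ← ENNReal.ofReal_pow (norm_nonneg _)]
  have hnn : 0 ≤ ∫ x in T, ‖f x‖ ^ 2 := integral_nonneg fun x => by positivity
  rw [h2, h3, show (4 : ENNReal) = ENNReal.ofReal 4 by norm_num,
    ← ENNReal.ofReal_mul (by norm_num)] at h1
  have hi : IntegrableOn (fun x => ‖prim f x‖ ^ 2 / x ^ 2) T := by
    refine ⟨hcont.aestronglyMeasurable hT, ?_⟩
    rw [hasFiniteIntegral_iff_ofReal (Eventually.of_forall fun x => by positivity)]
    exact h1.trans_lt ENNReal.ofReal_lt_top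
  refine ⟨hi, ?_⟩
  rw [← ofReal_integral_eq_lintegral_ofReal hi (Eventually.of_forall fun x => by positivity)] at h1
  exact (ENNReal.ofReal_le_ofReal_iff (by positivity)).1 h1

/-! ### The functionals on `H¹₀(ℝ⁺)` -/

lemma mass_nonneg (u : H10) : 0 ≤ mass u := sq_nonneg _

lemma mass_eq_integral (u : H10) : mass u = ∫ x in Ioi (0 : ℝ), ‖fn u x‖ ^ 2 :=
  norm_sq_eq_integral _

/-- The integral `∫₀^∞ |u|² / x² dx`. -/
def hardyIntegral (u : H10) : ℝ := ∫ x in Ioi (0 : ℝ), ‖fn u x‖ ^ 2 / x ^ 2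

lemma fn_hardy_ae_eq (u : H10) : (fun x => ‖fn u x‖ ^ 2 / x ^ 2)
    =ᵐ[volume.restrict (Ioi (0 : ℝ))] fun x => ‖rep u x‖ ^ 2 / x ^ 2 := by
  filter_upwards [fn_ae_eq_rep u] with x hx
  rw [hx]

lemma integrable_hardy (u : H10) :
    Integrable (fun x => ‖fn u x‖ ^ 2 / x ^ 2) (volume.restrict (Ioi (0 : ℝ))) :=
  (integrableOn_hardy (der u) measurableSet_Ioi subset_rfl
    fun _ _ _ ht => ht.1).1.congr (fn_hardy_ae_eq u).symm

lemma hardyIntegral_le (u : H10) : hardyIntegral u ≤ 4 * ‖der u‖ ^ 2 := by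
  rw [hardyIntegral, integral_congr_ae (fn_hardy_ae_eq u), norm_sq_eq_integral]
  exact (integrableOn_hardy (der u) measurableSet_Ioi subset_rfl fun _ _ _ ht => ht.1).2

lemma setIntegral_Ioc_hardy_le (u : H10) (A : ℝ) :
    ∫ x in Ioc 0 A, ‖fn u x‖ ^ 2 / x ^ 2 ≤ 4 * ∫ x in Ioc 0 A, ‖der u x‖ ^ 2 := by
  rw [integral_congr_ae (ae_restrict_Ioc_of_ae (fn_hardy_ae_eq u) le_rfl)]
  exact (integrableOn_hardy (der u) measurableSet_Ioc (fun _ ht => ht.1)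
    fun x hx _ ht => ⟨ht.1, ht.2.trans hx.2⟩).2

lemma norm_fn_ae_le {u : H10} {B : ℝ} (hB : ∀ x, 0 ≤ x → ‖rep u x‖ ≤ B) :
    ∀ᵐ x ∂(volume.restrict (Ioi (0 : ℝ))), ‖fn u x‖ ≤ B := by
  filter_upwards [fn_ae_eq_rep u, ae_restrict_mem measurableSet_Ioi] with x hx hx0
  rw [hx]
  exact hB x (le_of_lt hx0)

lemma rpow_add_one_le {p B s : ℝ} (hp : 1 < p) (hs : 0 ≤ s) (hsB : s ≤ B) :
    s ^ (p + 1) ≤ B ^ (p - 1) * s ^ 2 := by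
  rcases hs.eq_or_lt with h | h
  · subst h
    rw [Real.zero_rpow (by linarith)]
    simp
  · rw [show p + 1 = (p - 1) + 2 by ring, Real.rpow_add h, Real.rpow_two]
    have := Real.rpow_le_rpow hs hsB (by linarith : 0 ≤ p - 1)
    gcongr

lemma norm_rep_le_sqrt (u : H10) {x : ℝ} (hx : 0 ≤ x) :
    ‖rep u x‖ ≤ √(2 * (‖fn u‖ * ‖der u‖)) :=
  Real.le_sqrt_of_sq_le (norm_rep_sq_le u hx)

lemma aestronglyMeasurable_potential (p : ℝ) (hp : 1 < p) (u : H10) :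
    AEStronglyMeasurable (fun x => ‖fn u x‖ ^ (p + 1)) (volume.restrict (Ioi (0 : ℝ))) :=
  (Real.continuous_rpow_const (by linarith)).comp_aestronglyMeasurable
    (Lp.aestronglyMeasurable (fn u)).norm

lemma integrable_potential {p : ℝ} (hp : 1 < p) (u : H10) :
    Integrable (fun x => ‖fn u x‖ ^ (p + 1)) (volume.restrict (Ioi (0 : ℝ))) := by
  refine ((integrable_norm_sq (fn u)).const_mul
    ((√(2 * (‖fn u‖ * ‖der u‖))) ^ (p - 1))).mono' (aestronglyMeasurable_potential p hp u) ?_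
  filter_upwards [norm_fn_ae_le fun x hx => norm_rep_le_sqrt u hx] with x hx
  rw [Real.norm_of_nonneg (by positivity)]
  exact rpow_add_one_le hp (norm_nonneg _) hx

lemma potential_nonneg (p : ℝ) (u : H10) : 0 ≤ potential p u :=
  integral_nonneg fun x => by positivity

lemma potential_le_of_bound {p : ℝ} (hp : 1 < p) {u : H10} {B : ℝ}
    (hB : ∀ x, 0 ≤ x → ‖rep u x‖ ≤ B) : potential p u ≤ B ^ (p - 1) * mass u := by
  rw [mass_eq_integral, ← integral_const_mul]
  refine integral_mono_ae (integrable_potential hp u) ((integrable_norm_sq (fn u)).const_mul _) ?_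
  filter_upwards [norm_fn_ae_le hB] with x hx
  exact rpow_add_one_le hp (norm_nonneg _) hx

/-- The Gagliardo–Nirenberg inequality. -/
lemma potential_le {p : ℝ} (hp : 1 < p) (u : H10) :
    potential p u ≤ (2 * (‖fn u‖ * ‖der u‖)) ^ ((p - 1) / 2) * mass u := by
  have h := potential_le_of_bound hp (u := u) fun x hx => norm_rep_le_sqrt u hx
  rwa [Real.sqrt_eq_rpow, ← Real.rpow_mul (by positivity),
    show (1 / 2 * (p - 1) : ℝ) = (p - 1) / 2 by ring] at h

lemma hardy_eq (c : ℝ) (u : H10) : hardy c u = ‖der u‖ ^ 2 - c * hardyIntegral u := rfl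

lemma energy_eq (p c : ℝ) (u : H10) :
    energy p c u = 1 / 2 * hardy c u - 1 / (p + 1) * potential p u := by
  simp only [energy, hardy]
  ring

lemma le_hardy {c : ℝ} (hc : 0 < c) (u : H10) : (1 - 4 * c) * ‖der u‖ ^ 2 ≤ hardy c u := by
  rw [hardy_eq]
  nlinarith [hardyIntegral_le u]

lemma mass_smul (t : ℝ) (u : H10) : mass ((t : ℂ) • u) = t ^ 2 * mass u := by
  rw [mass, fn_smul, norm_smul, mul_pow, Complex.norm_real, Real.norm_eq_abs, sq_abs, mass]

lemma ae_norm_fn_smul (t : ℝ) (u : H10) :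
    ∀ᵐ x ∂(volume.restrict (Ioi (0 : ℝ))), ‖fn ((t : ℂ) • u) x‖ = |t| * ‖fn u x‖ := by
  rw [fn_smul]
  filter_upwards [Lp.coeFn_smul (t : ℂ) (fn u)] with x hx
  rw [hx, Pi.smul_apply, norm_smul, Complex.norm_real, Real.norm_eq_abs]

lemma hardy_smul (c t : ℝ) (u : H10) : hardy c ((t : ℂ) • u) = t ^ 2 * hardy c u := by
  have h : hardyIntegral ((t : ℂ) • u) = t ^ 2 * hardyIntegral u := by
    rw [hardyIntegral, hardyIntegral, ← integral_const_mul]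
    refine integral_congr_ae ?_
    filter_upwards [ae_norm_fn_smul t u] with x hx
    rw [hx, mul_pow, sq_abs, mul_div_assoc]
  rw [hardy_eq, hardy_eq, h, der_smul, norm_smul, mul_pow, Complex.norm_real, Real.norm_eq_abs,
    sq_abs]
  ring

lemma potential_smul (p : ℝ) {t : ℝ} (ht : 0 ≤ t) (u : H10) :
    potential p ((t : ℂ) • u) = t ^ (p + 1) * potential p u := by
  rw [potential, potential, ← integral_const_mul]
  refine integral_congr_ae ?_
  filter_upwards [ae_norm_fn_smul t u] with x hx
  rw [hx, abs_of_nonneg ht, Real.mul_rpow ht (norm_nonneg _)]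

/-- The quadratic part scales by `t²` and the potential term by `t^(p+1) ≥ t²`, with a negative
sign: concentrating mass is favourable. -/
lemma energy_smul_le {p c t : ℝ} (hp : 1 < p) (ht : 1 ≤ t) (u : H10) :
    energy p c ((t : ℂ) • u) ≤ t ^ 2 * energy p c u := by
  rw [energy_eq, energy_eq, hardy_smul, potential_smul p (by linarith)]
  have h1 : t ^ 2 ≤ t ^ (p + 1) := by
    rw [← Real.rpow_two]
    exact Real.rpow_le_rpow_of_exponent_le ht (by linarith)
  have h2 : 0 ≤ 1 / (p + 1) * potential p u :=
    mul_nonneg (by have : 0 < p + 1 := by linarith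
                   positivity) (potential_nonneg p u)
  nlinarith

/-! ### Lower bound for the energy at infinity -/

/-- The profile `√(t² - t^(p+1))` of the first integral of the soliton equation. -/
def solitonSlope (p t : ℝ) : ℝ := √(t ^ 2 - |t| ^ (p + 1))

/-- The primitive of `solitonSlope`. -/
def solitonPrim (p s : ℝ) : ℝ := ∫ t in (0 : ℝ)..s, solitonSlope p t

lemma continuous_solitonSlope {p : ℝ} (hp : 1 < p) : Continuous (solitonSlope p) := by
  have : Continuous fun t : ℝ => |t| ^ (p + 1) :=
    (Real.continuous_rpow_const (by linarith)).comp continuous_abs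
  unfold solitonSlope
  fun_prop

lemma hasDerivAt_solitonPrim {p : ℝ} (hp : 1 < p) (s : ℝ) :
    HasDerivAt (solitonPrim p) (solitonSlope p s) s :=
  (continuous_solitonSlope hp).integral_hasStrictDerivAt 0 s |>.hasDerivAt

lemma solitonPrim_zero (p : ℝ) : solitonPrim p 0 = 0 := by simp [solitonPrim]

lemma solitonSlope_le (p : ℝ) {t : ℝ} (ht : 0 ≤ t) : solitonSlope p t ≤ t := by
  refine Real.sqrt_le_iff.2 ⟨ht, ?_⟩
  linarith [Real.rpow_nonneg (abs_nonneg t) (p + 1)]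

lemma solitonSlope_nonneg (p t : ℝ) : 0 ≤ solitonSlope p t := Real.sqrt_nonneg _

lemma rpow_add_one_le_sq {p t : ℝ} (hp : 1 < p) (ht : 0 ≤ t) (ht1 : t ≤ 1) :
    t ^ (p + 1) ≤ t ^ 2 := by
  rw [← Real.rpow_two]
  exact Real.rpow_le_rpow_of_exponent_ge_of_imp ht ht1 (by linarith) (fun _ h => by linarith)

lemma solitonSlope_sq {p t : ℝ} (hp : 1 < p) (ht : 0 ≤ t) (ht1 : t ≤ 1) :
    solitonSlope p t ^ 2 = t ^ 2 - t ^ (p + 1) := by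
  rw [solitonSlope, abs_of_nonneg ht, Real.sq_sqrt]
  linarith [rpow_add_one_le_sq hp ht ht1]

lemma solitonPrim_le {p s : ℝ} (hp : 1 < p) (hs : 0 ≤ s) : solitonPrim p s ≤ s ^ 2 / 2 := by
  have h := intervalIntegral.integral_mono_on hs
    ((continuous_solitonSlope hp).intervalIntegrable (μ := volume) _ _)
    (continuous_id.intervalIntegrable _ _) (fun t ht => solitonSlope_le p ht.1)
  simpa [solitonPrim] using h

lemma solitonPrim_one_pos {p : ℝ} (hp : 1 < p) : 0 < solitonPrim p 1 := by
  refine intervalIntegral.intervalIntegral_pos_of_pos_on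
    ((continuous_solitonSlope hp).intervalIntegrable _ _) (fun t ht => ?_) one_pos
  refine Real.sqrt_pos.2 ?_
  rw [abs_of_pos ht.1, ← Real.rpow_two]
  linarith [Real.rpow_lt_rpow_of_exponent_gt ht.1 ht.2 (by linarith : 2 < p + 1)]

/-- The exponent `α` in the action `d ω ^ α` of the soliton of frequency `ω`. -/
def actionExp (p : ℝ) : ℝ := 1 / 2 + 2 / (p - 1)

/-- The constant `d` in the action `d ω ^ α` of the soliton of frequency `ω`. -/
def actionConst (p : ℝ) : ℝ := 2 * solitonPrim p 1 * ((p + 1) / 2) ^ (2 / (p - 1))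

lemma actionConst_pos {p : ℝ} (hp : 1 < p) : 0 < actionConst p :=
  mul_pos (mul_pos two_pos (solitonPrim_one_pos hp)) (Real.rpow_pos_of_pos (by linarith) _)

/-- This is mass subcriticality. It makes `d ω^α - ω μ / 2` convex in `ω` with a negative minimum.
-/
lemma actionExp_gt_one {p : ℝ} (hp : 1 < p) (hp5 : p < 5) : 1 < actionExp p := by
  have h : 1 / 2 < 2 / (p - 1) := by
    rw [div_lt_div_iff₀ two_pos (by linarith)]
    linarith
  rw [actionExp]
  linarith

/-- Solving for the amplitude gives `M² = ((p+1) ω / 2)^(2/(p-1))`, so `√ω M²` is a constant times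
`ω^(1/2 + 2/(p-1))`. The left side is `2 G(M)` for the calibration `G`. -/
lemma two_mul_sqrt_mul_sq_mul_solitonPrim {p M ω : ℝ} (hp : 1 < p) (hM : 0 < M)
    (hω : ω = 2 * M ^ (p - 1) / (p + 1)) :
    2 * (√ω * M ^ 2 * solitonPrim p 1) = actionConst p * ω ^ actionExp p := by
  have hp1 : p - 1 ≠ 0 := by linarith
  have hω0 : 0 < ω := by
    rw [hω]
    have := Real.rpow_pos_of_pos hM (p - 1)
    have : 0 < p + 1 := by linarith
    positivity
  have h1 : M ^ 2 = ((p + 1) / 2) ^ (2 / (p - 1)) * ω ^ (2 / (p - 1)) := by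
    rw [← Real.mul_rpow (by linarith) hω0.le,
      show (p + 1) / 2 * ω = M ^ (p - 1) by rw [hω]; field_simp [show p + 1 ≠ 0 by linarith],
      ← Real.rpow_mul hM.le, mul_div_cancel₀ _ hp1, Real.rpow_two]
  rw [actionConst, actionExp, Real.rpow_add hω0, ← Real.sqrt_eq_rpow, h1]
  ring

/-- The integrand of the energy without potential. -/
def freeDensity (p : ℝ) (u : H10) (x : ℝ) : ℝ :=
  1 / 2 * ‖der u x‖ ^ 2 - 1 / (p + 1) * ‖fn u x‖ ^ (p + 1)

lemma integrable_freeDensity {p : ℝ} (hp : 1 < p) (u : H10) :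
    Integrable (freeDensity p u) (volume.restrict (Ioi (0 : ℝ))) :=
  ((integrable_norm_sq (der u)).const_mul _).sub ((integrable_potential hp u).const_mul _)

lemma restrict_Ioi_le {A : ℝ} (hA : 0 ≤ A) :
    volume.restrict (Ioi A) ≤ volume.restrict (Ioi (0 : ℝ)) :=
  Measure.restrict_mono (Ioi_subset_Ioi hA) le_rfl

lemma setIntegral_Ioi_norm_sq_le_mass (u : H10) {A : ℝ} (hA : 0 ≤ A) :
    ∫ x in Ioi A, ‖fn u x‖ ^ 2 ≤ mass u := by
  rw [mass_eq_integral]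
  exact setIntegral_mono_set (integrable_norm_sq (fn u))
    (Eventually.of_forall fun x => by positivity) (Eventually.of_forall (Ioi_subset_Ioi hA))

/-- This is `2ab ≤ a² + b²` with `a² = ω r² - 2 r^(p+1) / (p+1)`. The choice of `ω` makes this
expression vanish at `r = M`, hence nonnegative for `0 ≤ r ≤ M`. -/
lemma slope_mul_le {p M ω r y : ℝ} (hp : 1 < p) (hM : 0 < M)
    (hω : ω = 2 * M ^ (p - 1) / (p + 1)) (hr : 0 ≤ r) (hrM : r ≤ M) :
    |√ω * M * solitonSlope p (r / M)| * y ≤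
      1 / 2 * y ^ 2 - 1 / (p + 1) * r ^ (p + 1) + ω / 2 * r ^ 2 := by
  have hω0 : 0 ≤ ω := by
    rw [hω]
    have := Real.rpow_pos_of_pos hM (p - 1)
    have : 0 < p + 1 := by linarith
    positivity
  rw [abs_of_nonneg (mul_nonneg (by positivity) (solitonSlope_nonneg _ _))]
  have h1 := solitonSlope_sq hp (t := r / M) (by positivity) ((div_le_one hM).2 hrM)
  have h2 : (√ω * M * solitonSlope p (r / M)) ^ 2 = ω * r ^ 2 - 2 / (p + 1) * r ^ (p + 1) := by
    rw [mul_pow, mul_pow, Real.sq_sqrt hω0, h1, Real.div_rpow hr hM.le,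
      show p + 1 = (p - 1) + 2 by ring, Real.rpow_add hM, Real.rpow_two, hω]
    have h3 := (Real.rpow_pos_of_pos hM (p - 1)).ne'
    have h4 : p + 1 ≠ 0 := by linarith
    have h5 : p - 1 + 2 ≠ 0 := by linarith
    field_simp
    ring
  have h3 := two_mul_le_add_sq (√ω * M * solitonSlope p (r / M)) y
  have h4 : 2 / (p + 1) * r ^ (p + 1) = 2 * (1 / (p + 1) * r ^ (p + 1)) := by ring
  nlinarith

/-- Continuity and decay: outside a compact interval `|u|` is at most its positive value at `x₁`. -/
lemma exists_isMaxOn_norm_rep (u : H10) {A x₁ : ℝ} (hA : 0 ≤ A) (hx₁ : A ≤ x₁)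
    (hpos : 0 < ‖rep u x₁‖) : ∃ x₀, A ≤ x₀ ∧ ∀ x, A ≤ x → ‖rep u x‖ ≤ ‖rep u x₀‖ := by
  have hc : ContinuousOn (fun x => ‖rep u x‖) (Ici A) :=
    ((continuousOn_prim (der u)).mono fun x hx => hA.trans hx).norm
  obtain ⟨N, hN⟩ := eventually_atTop.1 ((tendsto_norm_rep u).eventually_le_const hpos)
  obtain ⟨x₀, hx₀, hmax⟩ := hc.exists_isMaxOn' isClosed_Ici (x₀ := x₁) hx₁ (by
    rw [eventually_inf_principal]
    filter_upwards [isCompact_Icc (a := A) (b := max A N).compl_mem_cocompact] with x hx hxA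
    refine hN x ?_
    by_contra h
    exact hx ⟨hxA, (le_of_not_ge h).trans (le_max_right _ _)⟩)
  exact ⟨x₀, hx₀, fun x hx => hmax hx⟩

/-- Energy without potential on `(A, ∞)`, bounded below by the action of a soliton. -/
lemma exists_le_setIntegral_freeDensity {p : ℝ} (hp : 1 < p) (u : H10) {A : ℝ} (hA : 0 ≤ A) :
    ∃ ω, 0 ≤ ω ∧ ω ≤ 2 * (2 * (‖fn u‖ * ‖der u‖)) ^ ((p - 1) / 2) / (p + 1) ∧
      actionConst p * ω ^ actionExp p - ω / 2 * mass u - √ω / 2 * ‖rep u A‖ ^ 2 ≤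
        ∫ x in Ioi A, freeDensity p u x := by
  have hp1 : 0 < p + 1 := by linarith
  by_cases hex : ∃ x₁, A ≤ x₁ ∧ 0 < ‖rep u x₁‖
  swap
  · push Not at hex
    -- If `u` vanishes on `[A, ∞)` there is no amplitude to fix a frequency; with `ω = 0` the left
    -- side is zero, since `α ≠ 0`.
    refine ⟨0, le_rfl, by positivity, ?_⟩
    have hne : actionExp p ≠ 0 := by
      have : 0 < p - 1 := by linarith
      rw [actionExp]
      positivity
    rw [Real.zero_rpow hne, Real.sqrt_zero]
    simp only [mul_zero, zero_div, zero_mul, sub_zero]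
    refine integral_nonneg_of_ae ?_
    filter_upwards [ae_mono (restrict_Ioi_le hA) (fn_ae_eq_rep u),
      ae_restrict_mem measurableSet_Ioi] with x hx hxA
    have h0 : ‖fn u x‖ = 0 := by
      rw [hx]
      exact le_antisymm (hex x (le_of_lt hxA)) (norm_nonneg _)
    rw [freeDensity, h0, Real.zero_rpow (by linarith), Pi.zero_apply]
    simp
  obtain ⟨x₁, hx₁, hpos⟩ := hex
  obtain ⟨x₀, hx₀, hmax⟩ := exists_isMaxOn_norm_rep u hA hx₁ hpos
  set M : ℝ := ‖rep u x₀‖ with hMdef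
  have hM : 0 < M := hpos.trans_le (hmax x₁ hx₁)
  set ω : ℝ := 2 * M ^ (p - 1) / (p + 1) with hω
  have hω0 : 0 ≤ ω := by
    have := Real.rpow_pos_of_pos hM (p - 1)
    positivity
  -- The sup bound `M² ≤ 2 ‖u‖ ‖u'‖` keeps `ω` bounded along bounded sequences.
  have hωle : ω ≤ 2 * (2 * (‖fn u‖ * ‖der u‖)) ^ ((p - 1) / 2) / (p + 1) := by
    have h1 : M ^ (p - 1) ≤ (2 * (‖fn u‖ * ‖der u‖)) ^ ((p - 1) / 2) := by
      have h2 := Real.rpow_le_rpow (sq_nonneg M) (norm_rep_sq_le u (hA.trans hx₀))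
        (by linarith : 0 ≤ (p - 1) / 2)
      rwa [← Real.rpow_two, ← Real.rpow_mul hM.le, mul_div_cancel₀ _ two_ne_zero] at h2
    rw [hω]
    gcongr
  refine ⟨ω, hω0, hωle, ?_⟩
  -- The calibration: its derivative is `√(ω s² - 2 s^(p+1) / (p+1))` on `[0, M]`.
  set G : ℝ → ℝ := fun s => √ω * M ^ 2 * solitonPrim p (s / M) with hG
  set G' : ℝ → ℝ := fun s => √ω * M * solitonSlope p (s / M) with hG'
  have hGd : ∀ s, HasDerivAt G (G' s) s := by
    intro s
    have h1 := ((hasDerivAt_solitonPrim hp (s / M)).comp s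
      ((hasDerivAt_id s).div_const M)).const_mul (√ω * M ^ 2)
    refine HasDerivAt.congr_deriv (f := G) h1 ?_
    change √ω * M ^ 2 * (solitonSlope p (s / M) * (1 / M)) = √ω * M * solitonSlope p (s / M)
    field_simp
  have hGc : Continuous G' :=
    continuous_const.mul ((continuous_solitonSlope hp).comp (continuous_id.div_const M))
  set Q : ℝ → ℝ := fun x => freeDensity p u x + ω / 2 * ‖fn u x‖ ^ 2 with hQ
  have hQi : Integrable Q (volume.restrict (Ioi (0 : ℝ))) :=
    (integrable_freeDensity hp u).add ((integrable_norm_sq (fn u)).const_mul _)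
  have hseg : ∀ a b, A ≤ a → a ≤ b → |G ‖rep u b‖ - G ‖rep u a‖| ≤ ∫ x in Ioc a b, Q x := by
    intro a b ha hab
    have ha0 := hA.trans ha
    refine (abs_comp_norm_prim_sub_le (der u) hGd hGc ha0 hab).trans ?_
    refine integral_mono_of_nonneg (Eventually.of_forall fun x => by positivity)
      (hQi.mono_measure (Measure.restrict_mono (fun x hx => lt_of_le_of_lt ha0 hx.1) le_rfl)) ?_
    filter_upwards [ae_restrict_Ioc_of_ae (fn_ae_eq_rep u) ha0,
      ae_restrict_mem measurableSet_Ioc] with x hx hxm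
    simp only [hQ, freeDensity, hx]
    exact slope_mul_le hp hM rfl (norm_nonneg _) (hmax x (ha.trans hxm.1.le))
  have hQA : IntegrableOn Q (Ioi A) := hQi.mono_measure (restrict_Ioi_le hA)
  have hlim1 := intervalIntegral_tendsto_integral_Ioi A hQA tendsto_id
  have hlim2 : Tendsto (fun y => 2 * G M - G ‖rep u A‖ - G ‖rep u y‖) atTop
      (𝓝 (2 * G M - G ‖rep u A‖ - G 0)) :=
    ((hGd 0).continuousAt.tendsto.comp (tendsto_norm_rep u)).const_sub _
  -- `G(|u|)` climbs from its value at `A` to `G M` at the maximum, and then descends to `G 0` at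
  -- infinity.
  have hle : 2 * G M - G ‖rep u A‖ - G 0 ≤ ∫ x in Ioi A, Q x := by
    refine le_of_tendsto_of_tendsto hlim2 hlim1 ?_
    filter_upwards [eventually_ge_atTop x₀] with y hy
    have h1 := (le_abs_self _).trans (hseg A x₀ le_rfl hx₀)
    have h2 := (neg_le_abs _).trans (hseg x₀ y hx₀ hy)
    rw [id, intervalIntegral.integral_of_le (hx₀.trans hy), ← Ioc_union_Ioc_eq_Ioc hx₀ hy,
      setIntegral_union (Ioc_disjoint_Ioc_of_le le_rfl) measurableSet_Ioc
      (hQA.mono_set Ioc_subset_Ioi_self)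
      (hQA.mono_set fun x hx => lt_of_le_of_lt hx₀ hx.1)]
    linarith
  have hG0 : G 0 = 0 := by simp [hG, solitonPrim_zero]
  have hGM : 2 * G M = actionConst p * ω ^ actionExp p := by
    rw [← two_mul_sqrt_mul_sq_mul_solitonPrim hp hM rfl]
    simp only [hG, div_self hM.ne', ← hω]
  have hGA : G ‖rep u A‖ ≤ √ω / 2 * ‖rep u A‖ ^ 2 := by
    have h1 := solitonPrim_le hp (s := ‖rep u A‖ / M) (by positivity)
    have h2 := mul_le_mul_of_nonneg_left h1 (by positivity : 0 ≤ √ω * M ^ 2)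
    refine h2.trans (le_of_eq ?_)
    field_simp
  have hsplit : ∫ x in Ioi A, Q x =
      (∫ x in Ioi A, freeDensity p u x) + ω / 2 * ∫ x in Ioi A, ‖fn u x‖ ^ 2 := by
    rw [← integral_const_mul]
    exact integral_add ((integrable_freeDensity hp u).mono_measure (restrict_Ioi_le hA))
      (((integrable_norm_sq (fn u)).mono_measure (restrict_Ioi_le hA)).const_mul _)
  have hmass := mul_le_mul_of_nonneg_left (setIntegral_Ioi_norm_sq_le_mass u hA)
    (by positivity : 0 ≤ ω / 2)
  linarith

/-! ### Weak convergence in `H¹₀(ℝ⁺)` -/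

/-- Weak convergence of a sequence in `H¹₀(ℝ⁺)`. -/
def WeakTendsto (u : ℕ → H10) (v : H10) : Prop :=
  ∀ ℓ : H10 →L[ℂ] ℂ, Tendsto (fun n => ℓ (u n)) atTop (𝓝 (ℓ v))

instance : CompleteSpace H10 := by
  unfold H10
  infer_instance

instance : TopologicalSpace.SeparableSpace H10 := by
  have : Fact ((2 : ENNReal) ≠ ⊤) := ⟨by norm_num⟩
  have : SecondCountableTopology L2 := Lp.SecondCountableTopology
  infer_instance

/-- Riesz representation carries the sequence to the dual, where closed balls are weak-*
sequentially compact because the space is separable. Conjugate symmetry of the inner product then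
turns evaluations into functionals of the sequence. -/
lemma exists_weakTendsto_subseq {u : ℕ → H10} {C : ℝ} (hC : ∀ n, ‖u n‖ ≤ C) :
    ∃ k : ℕ → ℕ, StrictMono k ∧ ∃ v, WeakTendsto (u ∘ k) v := by
  have hs := WeakDual.isSeqCompact_closedBall (𝕜 := ℂ) (E := H10) 0 C
  obtain ⟨φ, -, k, hk, hlim⟩ := hs (x := fun n => StrongDual.toWeakDual
    (InnerProductSpace.toDual ℂ H10 (u n))) (fun n => by
    refine (mem_closedBall_zero_iff (E := StrongDual ℂ H10)).2 ?_
    exact ((InnerProductSpace.toDual ℂ H10).norm_map (u n)).trans_le (hC n))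
  refine ⟨k, hk, (InnerProductSpace.toDual ℂ H10).symm (WeakDual.toStrongDual φ), fun ℓ => ?_⟩
  set w := (InnerProductSpace.toDual ℂ H10).symm ℓ with hw
  have hℓ : ∀ x, ℓ x = inner ℂ w x := fun x => by rw [hw, InnerProductSpace.toDual_symm_apply]
  have h1 : Tendsto (fun n => inner ℂ (u (k n)) w) atTop (𝓝 (φ w)) :=
    ((WeakDual.eval_continuous w).tendsto φ).comp hlim
  have h2 : φ w = inner ℂ ((InnerProductSpace.toDual ℂ H10).symm (WeakDual.toStrongDual φ)) w := by
    rw [InnerProductSpace.toDual_symm_apply]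
    rfl
  rw [h2] at h1
  have h3 := (Complex.continuous_conj.tendsto _).comp h1
  simp only [hℓ]
  rw [← inner_conj_symm w]
  exact h3.congr fun n => inner_conj_symm w (u (k n))

/-- The derivative as a continuous linear map. -/
def derL : H10 →L[ℂ] L2 := (WithLp.sndL 2 ℂ L2 L2).comp H10.subtypeL

/-- The functional `u ↦ ⟪f, u'⟫`. -/
def innerDer (f : L2) : H10 →L[ℂ] ℂ := (innerSL ℂ f).comp derL

lemma innerDer_apply (f : L2) (u : H10) : innerDer f u = inner ℂ f (der u) := rfl

lemma WeakTendsto.sub_self {u : ℕ → H10} {v : H10} (h : WeakTendsto u v) :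
    WeakTendsto (fun n => u n - v) 0 := by
  intro ℓ
  simpa using (h ℓ).sub_const (ℓ v)

/-- Evaluation at `x` pairs `u'` with the indicator of `(0, x]`, so it is a continuous functional.
This gives local convergence directly, without a compact embedding. -/
lemma WeakTendsto.tendsto_rep {v : ℕ → H10} (h : WeakTendsto v 0) (x : ℝ) :
    Tendsto (fun n => ‖rep (v n) x‖) atTop (𝓝 0) := by
  have h1 := (h (innerDer (indicatorConstLp 2 measurableSet_Ioc (measure_Ioc_ne_top x) 1))).norm
  simpa [innerDer_apply, rep, prim_eq_inner, map_zero] using h1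

lemma WeakTendsto.tendsto_norm_fn {v : ℕ → H10} (h : WeakTendsto v 0) :
    ∀ᵐ x ∂(volume.restrict (Ioi (0 : ℝ))), Tendsto (fun n => ‖fn (v n) x‖) atTop (𝓝 0) := by
  filter_upwards [ae_all_iff.2 fun n => fn_ae_eq_rep (v n)] with x hx
  simp_rw [hx]
  exact h.tendsto_rep x

/-! ### Vanishing of cross terms -/

/-- Subtract `ε g²` from `f g`: the positive part of the difference is dominated by `f² / (4ε)`, so
its integral vanishes in the limit. What was subtracted costs at most `ε C`. -/
lemma tendsto_integral_mul_zero {ν : Measure ℝ} {f : ℝ → ℝ} {g : ℕ → ℝ → ℝ} {C : ℝ}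
    (hf0 : ∀ x, 0 ≤ f x) (hg0 : ∀ n x, 0 ≤ g n x) (hfm : AEStronglyMeasurable f ν)
    (hgm : ∀ n, AEStronglyMeasurable (g n) ν) (hf : Integrable (fun x => f x ^ 2) ν)
    (hg : ∀ n, Integrable (fun x => g n x ^ 2) ν) (hC : ∀ n, ∫ x, g n x ^ 2 ∂ν ≤ C)
    (hlim : ∀ᵐ x ∂ν, Tendsto (fun n => g n x) atTop (𝓝 0)) :
    Tendsto (fun n => ∫ x, f x * g n x ∂ν) atTop (𝓝 0) := by
  have hfg : ∀ n, Integrable (fun x => f x * g n x) ν := fun n =>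
    ((hf.add (hg n)).mono' (hfm.mul (hgm n)) (Eventually.of_forall fun x => by
      rw [Real.norm_of_nonneg (mul_nonneg (hf0 x) (hg0 n x)), Pi.add_apply]
      nlinarith [sq_nonneg (f x - g n x), mul_nonneg (hf0 x) (hg0 n x)]))
  have key : ∀ ε > 0, Tendsto (fun n => ∫ x, max (f x * g n x - ε * g n x ^ 2) 0 ∂ν) atTop
      (𝓝 0) := by
    intro ε hε
    have h0 : Tendsto (fun n => ∫ x, max (f x * g n x - ε * g n x ^ 2) 0 ∂ν) atTop
        (𝓝 (∫ _, (0 : ℝ) ∂ν)) := by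
      refine tendsto_integral_of_dominated_convergence (fun x => 1 / (4 * ε) * f x ^ 2)
        (fun n => ?_) (hf.const_mul _) (fun n => Eventually.of_forall fun x => ?_) ?_
      · exact ((hfm.mul (hgm n)).sub (((hgm n).pow 2).const_mul ε)).sup aestronglyMeasurable_const
      · rw [Real.norm_of_nonneg (le_max_right _ _)]
        refine max_le ?_ (by positivity)
        rw [div_mul_eq_mul_div, one_mul, le_div_iff₀ (by positivity)]
        nlinarith [sq_nonneg (f x - 2 * ε * g n x)]
      · filter_upwards [hlim] with x hx
        have h1 : Tendsto (fun n => max (f x * g n x - ε * g n x ^ 2) 0) atTop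
            (𝓝 (max (f x * 0 - ε * 0 ^ 2) 0)) :=
          ((hx.const_mul (f x)).sub ((hx.pow 2).const_mul ε)).max tendsto_const_nhds
        simpa using h1
    simpa using h0
  have hC0 : 0 ≤ C := (integral_nonneg fun x => sq_nonneg _).trans (hC 0)
  rw [Metric.tendsto_atTop]
  intro δ hδ
  have hε : 0 < δ / (2 * (C + 1)) := by positivity
  obtain ⟨N, hN⟩ := (Metric.tendsto_atTop.1 (key _ hε)) (δ / 2) (by positivity)
  refine ⟨N, fun n hn => ?_⟩
  have h1 := hN n hn
  set ε := δ / (2 * (C + 1)) with hεdef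
  rw [Real.dist_0_eq_abs, abs_of_nonneg (integral_nonneg fun x => le_max_right _ _)] at h1
  rw [Real.dist_0_eq_abs, abs_of_nonneg (integral_nonneg fun x => mul_nonneg (hf0 x) (hg0 n x))]
  have hWi : Integrable (fun x => max (f x * g n x - ε * g n x ^ 2) 0) ν :=
    ((hfg n).sub ((hg n).const_mul ε)).pos_part
  have h2 : ∫ x, f x * g n x ∂ν ≤
      (∫ x, max (f x * g n x - ε * g n x ^ 2) 0 ∂ν) + ε * ∫ x, g n x ^ 2 ∂ν := by
    rw [← integral_const_mul, ← integral_add hWi ((hg n).const_mul ε)]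
    refine integral_mono (hfg n) (hWi.add ((hg n).const_mul ε)) fun x => ?_
    linarith [le_max_left (f x * g n x - ε * g n x ^ 2) 0]
  have h3 : ε * ∫ x, g n x ^ 2 ∂ν ≤ ε * C := mul_le_mul_of_nonneg_left (hC n) hε.le
  have h4 : ε * C ≤ δ / 2 := by
    rw [hεdef, div_mul_eq_mul_div, div_le_div_iff₀ (by positivity) two_pos]
    nlinarith
  linarith

lemma tendsto_integral_zero_of_abs_le {ν : Measure ℝ} {F H : ℕ → ℝ → ℝ} {K : ℝ}
    (hH : ∀ n, Integrable (H n) ν) (hle : ∀ n, ∀ᵐ x ∂ν, |F n x| ≤ K * H n x)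
    (h : Tendsto (fun n => ∫ x, H n x ∂ν) atTop (𝓝 0)) :
    Tendsto (fun n => ∫ x, F n x ∂ν) atTop (𝓝 0) := by
  have h1 : Tendsto (fun n => K * ∫ x, H n x ∂ν) atTop (𝓝 0) := by simpa using h.const_mul K
  refine squeeze_zero_norm (fun n => ?_) h1
  rw [← integral_const_mul]
  exact (norm_integral_le_integral_norm _).trans (integral_mono_of_nonneg
    (Eventually.of_forall fun x => norm_nonneg _) ((hH n).const_mul K) (hle n))

lemma integral_sub_sub {ν : Measure ℝ} {f g h : ℝ → ℝ} (hf : Integrable f ν) (hg : Integrable g ν)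
    (hh : Integrable h ν) :
    ∫ x, (f x - g x - h x) ∂ν = (∫ x, f x ∂ν) - (∫ x, g x ∂ν) - ∫ x, h x ∂ν := by
  rw [← integral_sub hf hg]
  exact integral_sub (hf.sub hg) hh

lemma abs_norm_add_sq_sub_le (a b : ℂ) : |‖a + b‖ ^ 2 - ‖a‖ ^ 2 - ‖b‖ ^ 2| ≤ 2 * (‖a‖ * ‖b‖) := by
  have h1 := abs_norm_sub_norm_le (a + b) a
  have h2 := norm_add_le a b
  have h3 : ‖a‖ - ‖b‖ ≤ ‖a + b‖ := by
    have := norm_sub_norm_le a (-b)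
    simpa using this
  have h4 : ‖b‖ - ‖a‖ ≤ ‖a + b‖ := by
    have := norm_sub_norm_le b (-a)
    simpa [add_comm] using this
  have h5 : (‖a‖ - ‖b‖) ^ 2 ≤ ‖a + b‖ ^ 2 := by
    rw [← sq_abs (‖a‖ - ‖b‖)]
    exact pow_le_pow_left₀ (abs_nonneg _) (abs_sub_le_iff.2 ⟨h3, h4⟩) 2
  have h6 := pow_le_pow_left₀ (norm_nonneg _) h2 2
  rw [abs_le]
  constructor <;> nlinarith

lemma abs_rpow_sub_rpow_le {q α s : ℝ} (hq : 1 ≤ q) (hs : 0 ≤ s) (hsα : s ≤ 2 * α)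
    (hα : 0 ≤ α) : |s ^ q - α ^ q| ≤ q * (2 * α) ^ (q - 1) * |s - α| := by
  refine (convex_Icc (0 : ℝ) (2 * α)).norm_image_sub_le_of_norm_hasDerivWithin_le
    (f := fun t => t ^ q) (f' := fun t => q * t ^ (q - 1))
    (fun t _ => (Real.hasDerivAt_rpow_const (Or.inr hq)).hasDerivWithinAt) (fun t ht => ?_)
    ⟨hα, by linarith⟩ ⟨hs, hsα⟩
  have h1 := Real.rpow_le_rpow ht.1 ht.2 (by linarith : 0 ≤ q - 1)
  rw [Real.norm_of_nonneg (mul_nonneg (by linarith) (Real.rpow_nonneg ht.1 _))]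
  exact mul_le_mul_of_nonneg_left h1 (by linarith)

/-- A Brezis–Lieb inequality for bounded arguments. By symmetry `|b| ≤ |a|`; the mean value theorem
on `[0, 2|a|]` handles the first difference, and `|b|^(p+1)` is itself at most `B^(p-1) |a| |b|`. -/
lemma abs_norm_add_rpow_sub_le {p B : ℝ} (hp : 1 < p) (a b : ℂ) (ha : ‖a‖ ≤ B) (hb : ‖b‖ ≤ B) :
    |‖a + b‖ ^ (p + 1) - ‖a‖ ^ (p + 1) - ‖b‖ ^ (p + 1)| ≤
      ((p + 1) * 2 ^ p + 1) * B ^ (p - 1) * (‖a‖ * ‖b‖) := by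
  wlog hab : ‖b‖ ≤ ‖a‖ generalizing a b
  · have := this b a hb ha (le_of_not_ge hab)
    rwa [add_comm b a, sub_right_comm, mul_comm ‖b‖] at this
  have hB : 0 ≤ B := (norm_nonneg a).trans ha
  have h1 : |‖a + b‖ - ‖a‖| ≤ ‖b‖ := by
    have := abs_norm_sub_norm_le (a + b) a
    simpa using this
  have h2 := abs_rpow_sub_rpow_le (q := p + 1) (by linarith) (norm_nonneg (a + b))
    (by linarith [norm_add_le a b]) (norm_nonneg a)
  have h3 : (2 * ‖a‖) ^ (p + 1 - 1) * |‖a + b‖ - ‖a‖| ≤ 2 ^ p * B ^ (p - 1) * (‖a‖ * ‖b‖) := by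
    rw [show p + 1 - 1 = p by ring, Real.mul_rpow zero_le_two (norm_nonneg a)]
    have h4 : ‖a‖ ^ p ≤ B ^ (p - 1) * ‖a‖ := by
      rcases (norm_nonneg a).eq_or_lt with h | h
      · rw [← h, Real.zero_rpow (by linarith)]
        simp
      · have h5 := Real.rpow_le_rpow (norm_nonneg a) ha (by linarith : 0 ≤ p - 1)
        calc ‖a‖ ^ p = ‖a‖ ^ (p - 1) * ‖a‖ := by
              rw [← Real.rpow_add_one h.ne']; ring_nf
          _ ≤ _ := by gcongr
    calc 2 ^ p * ‖a‖ ^ p * |‖a + b‖ - ‖a‖| ≤ 2 ^ p * (B ^ (p - 1) * ‖a‖) * ‖b‖ := by gcongr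
      _ = _ := by ring
  have h6 : ‖b‖ ^ (p + 1) ≤ B ^ (p - 1) * (‖a‖ * ‖b‖) := by
    refine (rpow_add_one_le hp (norm_nonneg b) hb).trans ?_
    rw [sq]
    gcongr
  have h7 : (p + 1) * (2 * ‖a‖) ^ (p + 1 - 1) * |‖a + b‖ - ‖a‖| ≤
      (p + 1) * (2 ^ p * B ^ (p - 1) * (‖a‖ * ‖b‖)) := by
    rw [mul_assoc]
    exact mul_le_mul_of_nonneg_left h3 (by linarith)
  have h8 : 0 ≤ ‖b‖ ^ (p + 1) := by positivity
  have h9 := abs_le.1 (h2.trans h7)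
  rw [abs_le]
  constructor <;> nlinarith [h9.1, h9.2]

/-! ### Splitting of the functionals along weakly convergent sequences -/

section Splitting

variable {u : ℕ → H10} {v : H10} {C : ℝ}

lemma ae_fn_eq_add (u v : H10) :
    ∀ᵐ x ∂(volume.restrict (Ioi (0 : ℝ))), fn u x = fn v x + fn (u - v) x := by
  rw [fn_sub]
  filter_upwards [Lp.coeFn_sub (fn u) (fn v)] with x hx
  rw [hx, Pi.sub_apply, add_sub_cancel]

lemma mass_le_norm_sq (u : H10) : mass u ≤ ‖u‖ ^ 2 := by
  rw [norm_sq_eq]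
  linarith [sq_nonneg ‖der u‖]

lemma norm_fn_le (u : H10) : ‖fn u‖ ≤ ‖u‖ :=
  abs_le_of_sq_le_sq' (mass_le_norm_sq u) (norm_nonneg _) |>.2

lemma norm_der_le (u : H10) : ‖der u‖ ≤ ‖u‖ := by
  refine abs_le_of_sq_le_sq' ?_ (norm_nonneg _) |>.2
  rw [norm_sq_eq]
  linarith [mass_nonneg u]

lemma norm_rep_le (u : H10) {x : ℝ} (hx : 0 ≤ x) : ‖rep u x‖ ≤ 2 * ‖u‖ := by
  refine abs_le_of_sq_le_sq' ((norm_rep_sq_le u hx).trans ?_) (by positivity) |>.2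
  have := mul_le_mul (norm_fn_le u) (norm_der_le u) (norm_nonneg _) (norm_nonneg _)
  nlinarith [sq_nonneg ‖u‖]

/-- The errors in splitting the mass and the potential term are pointwise `O(|v| |w|)` for a
remainder `w`, so this limit disposes of both. The Hardy integral needs the variant divided by `x²`.
-/
lemma tendsto_cross (hC : ∀ n, ‖u n‖ ≤ C) (h : WeakTendsto u 0) (v : H10) :
    Tendsto (fun n => ∫ x in Ioi (0 : ℝ), ‖fn v x‖ * ‖fn (u n) x‖) atTop (𝓝 0) := by
  refine tendsto_integral_mul_zero (C := C ^ 2) (fun x => norm_nonneg _) (fun n x => norm_nonneg _)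
    (Lp.aestronglyMeasurable _).norm (fun n => (Lp.aestronglyMeasurable _).norm)
    (integrable_norm_sq _) (fun n => integrable_norm_sq _) (fun n => ?_) h.tendsto_norm_fn
  rw [← norm_sq_eq_integral]
  exact pow_le_pow_left₀ (norm_nonneg _) ((norm_fn_le _).trans (hC n)) 2

lemma tendsto_cross_hardy (hC : ∀ n, ‖u n‖ ≤ C) (h : WeakTendsto u 0) (v : H10) :
    Tendsto (fun n => ∫ x in Ioi (0 : ℝ), (‖fn v x‖ / |x|) * (‖fn (u n) x‖ / |x|)) atTop
      (𝓝 0) := by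
  have hm : ∀ w : H10, AEStronglyMeasurable (fun x => ‖fn w x‖ / |x|)
      (volume.restrict (Ioi (0 : ℝ))) := fun w =>
    ((Lp.aestronglyMeasurable _).norm.aemeasurable.div
      (measurable_id.abs.aemeasurable)).aestronglyMeasurable
  have hi : ∀ w : H10, Integrable (fun x => (‖fn w x‖ / |x|) ^ 2)
      (volume.restrict (Ioi (0 : ℝ))) := fun w => by
    simpa only [div_pow, sq_abs] using integrable_hardy w
  refine tendsto_integral_mul_zero (C := 4 * C ^ 2) (fun x => by positivity)
    (fun n x => by positivity) (hm v) (fun n => hm _) (hi v) (fun n => hi _) (fun n => ?_) ?_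
  · simp only [div_pow, sq_abs]
    refine (hardyIntegral_le (u n)).trans ?_
    have := pow_le_pow_left₀ (norm_nonneg _) ((norm_der_le _).trans (hC n)) 2
    linarith
  · filter_upwards [h.tendsto_norm_fn] with x hx
    simpa using hx.div_const |x|

lemma tendsto_mass_sub (hC : ∀ n, ‖u n - v‖ ≤ C) (h : WeakTendsto u v) :
    Tendsto (fun n => mass (u n) - mass v - mass (u n - v)) atTop (𝓝 0) := by
  have h1 := tendsto_integral_zero_of_abs_le (K := 2)
    (F := fun n x => ‖fn (u n) x‖ ^ 2 - ‖fn v x‖ ^ 2 - ‖fn (u n - v) x‖ ^ 2)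
    (fun n => integrable_norm_mul_norm (fn v) (fn (u n - v))) (fun n => ?_)
    (tendsto_cross hC h.sub_self v)
  · refine h1.congr fun n => ?_
    rw [integral_sub_sub (integrable_norm_sq _) (integrable_norm_sq _) (integrable_norm_sq _)]
    simp only [mass_eq_integral]
  · filter_upwards [ae_fn_eq_add (u n) v] with x hx
    rw [hx]
    exact abs_norm_add_sq_sub_le _ _

lemma tendsto_hardyIntegral_sub (hC : ∀ n, ‖u n - v‖ ≤ C) (h : WeakTendsto u v) :
    Tendsto (fun n => hardyIntegral (u n) - hardyIntegral v - hardyIntegral (u n - v)) atTop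
      (𝓝 0) := by
  have hi : ∀ n, Integrable (fun x => (‖fn v x‖ / |x|) * (‖fn (u n - v) x‖ / |x|))
      (volume.restrict (Ioi (0 : ℝ))) := fun n => by
    refine ((integrable_hardy v).add (integrable_hardy (u n - v))).mono' ?_ ?_
    · exact ((((Lp.aestronglyMeasurable _).norm.aemeasurable.div
        (measurable_id.abs.aemeasurable))).mul ((Lp.aestronglyMeasurable _).norm.aemeasurable.div
        (measurable_id.abs.aemeasurable))).aestronglyMeasurable
    · refine Eventually.of_forall fun x => ?_
      rw [Real.norm_of_nonneg (by positivity), Pi.add_apply, ← sq_abs x, ← div_pow, ← div_pow]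
      have h1 : 0 ≤ ‖fn v x‖ / |x| := by positivity
      have h2 : 0 ≤ ‖fn (u n - v) x‖ / |x| := by positivity
      nlinarith [sq_nonneg (‖fn v x‖ / |x| - ‖fn (u n - v) x‖ / |x|)]
  have h1 := tendsto_integral_zero_of_abs_le (K := 2)
    (F := fun n x => ‖fn (u n) x‖ ^ 2 / x ^ 2 - ‖fn v x‖ ^ 2 / x ^ 2 -
      ‖fn (u n - v) x‖ ^ 2 / x ^ 2) hi (fun n => ?_) (tendsto_cross_hardy hC h.sub_self v)
  · refine h1.congr fun n => ?_
    rw [integral_sub_sub (integrable_hardy _) (integrable_hardy _) (integrable_hardy _)]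
    rfl
  · filter_upwards [ae_fn_eq_add (u n) v] with x hx
    rw [hx, ← sub_div, ← sub_div, abs_div, abs_of_nonneg (sq_nonneg x), div_mul_div_comm,
      ← sq, sq_abs, ← mul_div_assoc]
    exact div_le_div_of_nonneg_right (abs_norm_add_sq_sub_le _ _) (sq_nonneg x)

lemma tendsto_potential_sub (hC : ∀ n, ‖u n - v‖ ≤ C) (h : WeakTendsto u v) {p : ℝ}
    (hp : 1 < p) :
    Tendsto (fun n => potential p (u n) - potential p v - potential p (u n - v)) atTop
      (𝓝 0) := by
  set B := max (2 * ‖v‖) (2 * C) with hB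
  have h1 := tendsto_integral_zero_of_abs_le (K := ((p + 1) * 2 ^ p + 1) * B ^ (p - 1))
    (F := fun n x => ‖fn (u n) x‖ ^ (p + 1) - ‖fn v x‖ ^ (p + 1) - ‖fn (u n - v) x‖ ^ (p + 1))
    (fun n => integrable_norm_mul_norm (fn v) (fn (u n - v))) (fun n => ?_)
    (tendsto_cross hC h.sub_self v)
  · refine h1.congr fun n => ?_
    have hi := integrable_potential hp
    rw [integral_sub_sub (hi _) (hi _) (hi _)]
    rfl
  · filter_upwards [ae_fn_eq_add (u n) v,
      norm_fn_ae_le (u := v) (B := B) fun x hx => (norm_rep_le v hx).trans (le_max_left _ _),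
      norm_fn_ae_le (u := u n - v) (B := B) fun x hx =>
        ((norm_rep_le _ hx).trans (mul_le_mul_of_nonneg_left (hC n) zero_le_two)).trans
          (le_max_right _ _)] with x hx h2 h3
    rw [hx]
    exact abs_norm_add_rpow_sub_le hp _ _ h2 h3

lemma tendsto_norm_der_sq_sub (h : WeakTendsto u v) :
    Tendsto (fun n => ‖der (u n)‖ ^ 2 - ‖der v‖ ^ 2 - ‖der (u n - v)‖ ^ 2) atTop (𝓝 0) := by
  have h1 := ((Complex.continuous_re.tendsto _).comp (h.sub_self (innerDer (der v)))).const_mul 2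
  rw [map_zero, Complex.zero_re, mul_zero] at h1
  refine h1.congr fun n => ?_
  have h2 : der (u n) = der v + der (u n - v) := by rw [der_sub, add_sub_cancel]
  have h3 := norm_add_sq (𝕜 := ℂ) (der v) (der (u n - v))
  rw [← h2] at h3
  rw [h3]
  simp only [Function.comp, innerDer_apply, RCLike.re_to_complex]
  ring

lemma tendsto_energy_sub (hC : ∀ n, ‖u n - v‖ ≤ C) (h : WeakTendsto u v) {p : ℝ}
    (hp : 1 < p) (c : ℝ) :
    Tendsto (fun n => energy p c (u n) - energy p c v - energy p c (u n - v)) atTop (𝓝 0) := by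
  have h1 := ((tendsto_norm_der_sq_sub h).const_mul (1 / 2)).sub
    ((tendsto_hardyIntegral_sub hC h).const_mul (c / 2))
  have h2 := h1.sub ((tendsto_potential_sub hC h hp).const_mul (1 / (p + 1)))
  simp only [mul_zero, sub_zero] at h2
  refine h2.congr fun n => ?_
  simp only [energy_eq, hardy_eq]
  ring

end Splitting

/-! ### The energy level of the soliton on the whole line -/

/-- The frequency of the soliton of mass `μ`. -/
def optFreq (p μ : ℝ) : ℝ := (μ / (2 * actionConst p * actionExp p)) ^ (1 / (actionExp p - 1))

/-- The energy, without potential, of the soliton of mass `μ`. -/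
def freeLevel (p μ : ℝ) : ℝ :=
  actionConst p * optFreq p μ ^ actionExp p - optFreq p μ / 2 * μ

section

variable {p μ : ℝ}

lemma optFreq_pos (hp : 1 < p) (hp5 : p < 5) (hμ : 0 < μ) : 0 < optFreq p μ := by
  have h1 := actionExp_gt_one hp hp5
  have h2 := actionConst_pos hp
  have : 0 < actionExp p := by linarith
  exact Real.rpow_pos_of_pos (by positivity) _

/-- The stationarity condition at `optFreq` for `ω ↦ d ω^α - ω μ / 2`. -/
lemma two_mul_actionConst_mul_rpow (hp : 1 < p) (hp5 : p < 5) (hμ : 0 < μ) :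
    2 * actionConst p * actionExp p * optFreq p μ ^ (actionExp p - 1) = μ := by
  have h1 := actionExp_gt_one hp hp5
  have h2 := actionConst_pos hp
  have h3 : 0 < actionExp p := by linarith
  rw [optFreq, ← Real.rpow_mul (by positivity), one_div_mul_cancel (by linarith), Real.rpow_one]
  field_simp

lemma actionConst_mul_optFreq_rpow (hp : 1 < p) (hp5 : p < 5) (hμ : 0 < μ) :
    2 * actionExp p * (actionConst p * optFreq p μ ^ actionExp p) = optFreq p μ * μ := by
  have h1 := two_mul_actionConst_mul_rpow hp hp5 hμ
  have h2 : optFreq p μ ^ actionExp p = optFreq p μ ^ (actionExp p - 1) * optFreq p μ := by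
    rw [← Real.rpow_add_one (optFreq_pos hp hp5 hμ).ne', sub_add_cancel]
  rw [h2]
  linear_combination optFreq p μ * h1

/-- By stationarity the level equals `(1 - α) d ω^α`, and `α > 1`. -/
lemma freeLevel_neg (hp : 1 < p) (hp5 : p < 5) (hμ : 0 < μ) : freeLevel p μ < 0 := by
  have h1 := actionConst_mul_optFreq_rpow hp hp5 hμ
  have h2 := actionExp_gt_one hp hp5
  have h3 := mul_pos (actionConst_pos hp)
    (Real.rpow_pos_of_pos (optFreq_pos hp hp5 hμ) (actionExp p))
  rw [freeLevel]
  nlinarith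

/-- A stationary point of a convex function is a minimum: Bernoulli's inequality is the tangent line
bound for `ω^α` at `optFreq`. -/
lemma freeLevel_le (hp : 1 < p) (hp5 : p < 5) (hμ : 0 < μ) {ω : ℝ} (hω : 0 ≤ ω) :
    freeLevel p μ ≤ actionConst p * ω ^ actionExp p - ω / 2 * μ := by
  have h0 := optFreq_pos hp hp5 hμ
  have h1 := actionConst_mul_optFreq_rpow hp hp5 hμ
  have h2 := actionExp_gt_one hp hp5
  have h3 := one_add_mul_self_le_rpow_one_add (s := ω / optFreq p μ - 1) (p := actionExp p)
    (by linarith [div_nonneg hω h0.le]) h2.le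
  rw [add_sub_cancel, Real.div_rpow hω h0.le, le_div_iff₀ (Real.rpow_pos_of_pos h0 _)] at h3
  have h4 := mul_le_mul_of_nonneg_left h3 (actionConst_pos hp).le
  have h5 : actionConst p * ((1 + actionExp p * (ω / optFreq p μ - 1)) *
      optFreq p μ ^ actionExp p) = actionConst p * optFreq p μ ^ actionExp p +
      (ω / optFreq p μ - 1) * (optFreq p μ * μ) / 2 := by
    rw [← h1]
    ring
  have h6 : (ω / optFreq p μ - 1) * (optFreq p μ * μ) = (ω - optFreq p μ) * μ := by
    field_simp
  rw [h5, h6] at h4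
  rw [freeLevel]
  linarith

/-- Multiply the bound for mass `μ` by `b / μ` and restore the nonnegative quantity `(1 - b / μ) d
ω^α`. -/
lemma div_mul_freeLevel_le (hp : 1 < p) (hp5 : p < 5) (hμ : 0 < μ) {ω b : ℝ} (hω : 0 ≤ ω)
    (hb : b / μ ≤ 1) (hb0 : 0 ≤ b) :
    b / μ * freeLevel p μ ≤ actionConst p * ω ^ actionExp p - ω / 2 * b := by
  have h1 := mul_le_mul_of_nonneg_left (freeLevel_le hp hp5 hμ hω) (div_nonneg hb0 hμ.le)
  have h2 : 0 ≤ actionConst p * ω ^ actionExp p :=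
    mul_nonneg (actionConst_pos hp).le (Real.rpow_nonneg hω _)
  have h3 : b / μ * (actionConst p * ω ^ actionExp p - ω / 2 * μ) =
      b / μ * (actionConst p * ω ^ actionExp p) - ω / 2 * b := by
    field_simp
  nlinarith

end

/-! ### Weakly null sequences -/

/-- For weakly null sequences the pieces behave differently: on `(0, A]` the potential term vanishes
in the limit and Hardy's inequality controls the rest, while on `(A, ∞)` the attractive term is
small and the calibration applies. -/
lemma energy_split {p c A : ℝ} (hp : 1 < p) (hA : 0 ≤ A) (u : H10) :
    energy p c u = (1 / 2 * (∫ x in Ioc 0 A, ‖der u x‖ ^ 2)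
        - c / 2 * ∫ x in Ioc 0 A, ‖fn u x‖ ^ 2 / x ^ 2)
      + (∫ x in Ioi A, freeDensity p u x) - c / 2 * (∫ x in Ioi A, ‖fn u x‖ ^ 2 / x ^ 2)
      - 1 / (p + 1) * ∫ x in Ioc 0 A, ‖fn u x‖ ^ (p + 1) := by
  have hs : ∀ f : ℝ → ℝ, Integrable f (volume.restrict (Ioi (0 : ℝ))) →
      ∫ x in Ioi (0 : ℝ), f x = (∫ x in Ioc 0 A, f x) + ∫ x in Ioi A, f x := by
    intro f hf
    rw [← Ioc_union_Ioi_eq_Ioi hA, setIntegral_union (Ioc_disjoint_Ioi le_rfl) measurableSet_Ioi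
      (hf.mono_measure (Measure.restrict_mono Ioc_subset_Ioi_self le_rfl))
      (hf.mono_measure (restrict_Ioi_le hA))]
  have h1 : ∫ x in Ioi A, freeDensity p u x = 1 / 2 * (∫ x in Ioi A, ‖der u x‖ ^ 2) -
      1 / (p + 1) * ∫ x in Ioi A, ‖fn u x‖ ^ (p + 1) := by
    rw [← integral_const_mul, ← integral_const_mul]
    exact integral_sub
      (((integrable_norm_sq (der u)).mono_measure (restrict_Ioi_le hA)).const_mul _)
      (((integrable_potential hp u).mono_measure (restrict_Ioi_le hA)).const_mul _)
  rw [energy, potential, norm_sq_eq_integral, hs _ (integrable_norm_sq (der u)),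
    hs _ (integrable_hardy u), hs _ (integrable_potential hp u), h1]
  ring

lemma setIntegral_Ioi_hardy_le (u : H10) {A : ℝ} (hA : 0 < A) :
    ∫ x in Ioi A, ‖fn u x‖ ^ 2 / x ^ 2 ≤ mass u / A ^ 2 := by
  have h1 : ∫ x in Ioi A, ‖fn u x‖ ^ 2 / x ^ 2 ≤ ∫ x in Ioi A, 1 / A ^ 2 * ‖fn u x‖ ^ 2 := by
    refine setIntegral_mono_on ((integrable_hardy u).mono_measure (restrict_Ioi_le hA.le))
      (((integrable_norm_sq (fn u)).mono_measure (restrict_Ioi_le hA.le)).const_mul _)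
      measurableSet_Ioi fun x hx => ?_
    have hx' : A < x := hx
    rw [div_mul_eq_mul_div, one_mul]
    gcongr
  rw [integral_const_mul] at h1
  refine h1.trans ?_
  rw [div_mul_eq_mul_div, one_mul]
  gcongr
  exact setIntegral_Ioi_norm_sq_le_mass u hA.le

lemma WeakTendsto.tendsto_setIntegral_potential {p C A : ℝ} (hp : 1 < p) {v : ℕ → H10}
    (h : WeakTendsto v 0) (hC : ∀ n, ‖v n‖ ≤ C) :
    Tendsto (fun n => ∫ x in Ioc 0 A, ‖fn (v n) x‖ ^ (p + 1)) atTop (𝓝 0) := by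
  have h0 : Tendsto (fun n => ∫ x in Ioc 0 A, ‖fn (v n) x‖ ^ (p + 1)) atTop
      (𝓝 (∫ x in Ioc 0 A, (0 : ℝ))) := by
    refine tendsto_integral_of_dominated_convergence (fun _ => (2 * C) ^ (p + 1))
      (fun n => (aestronglyMeasurable_potential p hp (v n)).mono_measure
        (Measure.restrict_mono Ioc_subset_Ioi_self le_rfl)) (integrable_const _)
      (fun n => ?_) ?_
    · filter_upwards [ae_restrict_Ioc_of_ae (norm_fn_ae_le (u := v n) (B := 2 * C) fun x hx =>
        (norm_rep_le _ hx).trans (by linarith [hC n])) le_rfl] with x hx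
      rw [Real.norm_of_nonneg (by positivity)]
      exact Real.rpow_le_rpow (norm_nonneg _) hx (by linarith)
    · filter_upwards [ae_restrict_Ioc_of_ae h.tendsto_norm_fn le_rfl] with x hx
      have h1 := hx.rpow_const (p := p + 1) (Or.inr (by linarith))
      rwa [Real.zero_rpow (by linarith)] at h1
  simpa using h0

/-- A weakly null sequence has asymptotically at least the energy of a soliton. -/
lemma WeakTendsto.eventually_le_energy {p c μ b C : ℝ} (hp : 1 < p) (hp5 : p < 5) (hc0 : 0 < c)
    (hc : c < 1 / 4) (hμ : 0 < μ) (hb : b ≤ μ) {v : ℕ → H10} (h : WeakTendsto v 0)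
    (hC : ∀ n, ‖v n‖ ≤ C) (hmass : Tendsto (fun n => mass (v n)) atTop (𝓝 b)) {ε : ℝ}
    (hε : 0 < ε) : ∀ᶠ n in atTop, b / μ * freeLevel p μ - ε ≤ energy p c (v n) := by
  have hC0 : 0 ≤ C := (norm_nonneg _).trans (hC 0)
  have hb0 : 0 ≤ b := ge_of_tendsto' hmass fun n => mass_nonneg _
  have hb1 : b / μ ≤ 1 := (div_le_one hμ).2 hb
  have hp1 : 0 < p + 1 := by linarith
  -- A bound, uniform in `n`, for the frequencies produced by the calibration; it makes the error
  -- terms in `herr` independent of them.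
  set W : ℝ := 2 * (2 * (C * C)) ^ ((p - 1) / 2) / (p + 1) with hW
  obtain ⟨A, hA0, hA⟩ : ∃ A : ℝ, 0 < A ∧ c / 2 * (C ^ 2 / A ^ 2) < ε / 2 := by
    have h1 : Tendsto (fun A : ℝ => c / 2 * (C ^ 2 / A ^ 2)) atTop (𝓝 (c / 2 * 0)) :=
      (Tendsto.div_atTop tendsto_const_nhds (tendsto_pow_atTop two_ne_zero)).const_mul _
    rw [mul_zero] at h1
    exact ((eventually_gt_atTop 0).and (h1.eventually_lt_const (half_pos hε))).exists
  have herr : Tendsto (fun n => W / 2 * |mass (v n) - b| + √W / 2 * ‖rep (v n) A‖ ^ 2 +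
      1 / (p + 1) * ∫ x in Ioc 0 A, ‖fn (v n) x‖ ^ (p + 1)) atTop (𝓝 0) := by
    have h1 := ((hmass.sub_const b).abs.const_mul (W / 2)).add
      (((h.tendsto_rep A).pow 2).const_mul (√W / 2))
    have h2 := h1.add ((h.tendsto_setIntegral_potential (A := A) hp hC).const_mul (1 / (p + 1)))
    simpa using h2
  filter_upwards [herr.eventually_lt_const (half_pos hε)] with n hn
  obtain ⟨ω, hω0, hωle, hω⟩ := exists_le_setIntegral_freeDensity hp (v n) hA0.le
  have hωW : ω ≤ W := by
    refine hωle.trans ?_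
    have h1 := (norm_fn_le (v n)).trans (hC n)
    have h2 := (norm_der_le (v n)).trans (hC n)
    have h3 : 0 ≤ (p - 1) / 2 := by linarith
    rw [hW]
    gcongr
  have h1 := div_mul_freeLevel_le hp hp5 hμ hω0 hb1 hb0
  have h2 : ω / 2 * mass (v n) ≤ ω / 2 * b + W / 2 * |mass (v n) - b| := by
    have h3 : ω / 2 * (mass (v n) - b) ≤ W / 2 * |mass (v n) - b| := by
      refine (mul_le_mul_of_nonneg_left (le_abs_self _) (by positivity)).trans ?_
      gcongr
    linarith
  have h3 : √ω / 2 * ‖rep (v n) A‖ ^ 2 ≤ √W / 2 * ‖rep (v n) A‖ ^ 2 := by gcongr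
  have h4 : c / 2 * (∫ x in Ioi A, ‖fn (v n) x‖ ^ 2 / x ^ 2) < ε / 2 := by
    refine lt_of_le_of_lt ?_ hA
    have h5 := (mass_le_norm_sq (v n)).trans (pow_le_pow_left₀ (norm_nonneg _) (hC n) 2)
    refine mul_le_mul_of_nonneg_left ((setIntegral_Ioi_hardy_le (v n) hA0).trans ?_)
      (by positivity)
    gcongr
  -- Hardy's inequality on `(0, A]` with `4c < 1`.
  have h5 : 0 ≤ 1 / 2 * (∫ x in Ioc 0 A, ‖der (v n) x‖ ^ 2)
      - c / 2 * ∫ x in Ioc 0 A, ‖fn (v n) x‖ ^ 2 / x ^ 2 := by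
    have h6 := setIntegral_Ioc_hardy_le (v n) A
    have h7 : 0 ≤ ∫ x in Ioc 0 A, ‖der (v n) x‖ ^ 2 := integral_nonneg fun x => by positivity
    nlinarith
  rw [energy_split hp hA0.le]
  linarith

/-! ### Boundedness -/

/-- If `y > 1`, then `y^q ≥ 1` absorbs `B`, and dividing by `y^q` leaves the positive power `2 - q`
of `y`. In the application `q = (p-1)/2`, so `q < 2` is the condition `p < 5`. -/
lemma le_of_sq_le_add_rpow {κ B K q y : ℝ} (hκ : 0 < κ) (hB : 0 ≤ B) (hq0 : 0 ≤ q)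
    (hq : q < 2) (h : κ * y ^ 2 ≤ B + K * y ^ q) :
    y ≤ max 1 (((B + K) / κ) ^ (1 / (2 - q))) := by
  by_contra hlt
  push Not at hlt
  obtain ⟨hy1, hy2⟩ := max_lt_iff.1 hlt
  have hy0 : 0 < y := by linarith
  have h1 : κ * y ^ (2 - q) ≤ B + K := by
    have h2 : y ^ 2 = y ^ (2 - q) * y ^ q := by
      rw [← Real.rpow_add hy0, sub_add_cancel, Real.rpow_two]
    have h3 : 1 ≤ y ^ q := Real.one_le_rpow hy1.le hq0
    have h4 : κ * y ^ (2 - q) * y ^ q ≤ (B + K) * y ^ q := by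
      rw [mul_assoc, ← h2]
      nlinarith
    exact le_of_mul_le_mul_right h4 (by linarith)
  have h2 : y ^ (2 - q) ≤ (B + K) / κ := by
    rw [le_div_iff₀ hκ]
    linarith
  have h3 := Real.rpow_le_rpow (by positivity) h2 (by
    have : 0 < 2 - q := by linarith
    positivity : 0 ≤ 1 / (2 - q))
  rw [← Real.rpow_mul hy0.le, mul_one_div_cancel (by linarith), Real.rpow_one] at h3
  linarith

lemma le_energy {p c : ℝ} (hc0 : 0 < c) (u : H10) :
    (1 - 4 * c) / 2 * ‖der u‖ ^ 2 - 1 / (p + 1) * potential p u ≤ energy p c u := by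
  rw [energy_eq]
  linarith [le_hardy hc0 u]

lemma potential_le_of_mass_le {p m₀ : ℝ} (hp : 1 < p) {u : H10} (hm : mass u ≤ m₀) :
    potential p u ≤ (2 * √m₀) ^ ((p - 1) / 2) * m₀ * ‖der u‖ ^ ((p - 1) / 2) := by
  have h1 : ‖fn u‖ ≤ √m₀ := Real.le_sqrt_of_sq_le hm
  have h2 : 0 ≤ (p - 1) / 2 := by linarith
  have h3 := mass_nonneg u
  calc potential p u ≤ (2 * (‖fn u‖ * ‖der u‖)) ^ ((p - 1) / 2) * mass u := potential_le hp u
    _ ≤ (2 * √m₀ * ‖der u‖) ^ ((p - 1) / 2) * m₀ := by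
        rw [← mul_assoc]
        gcongr
    _ = _ := by
        rw [Real.mul_rpow (by positivity) (norm_nonneg _)]
        ring

lemma exists_norm_der_le {p c : ℝ} (hp : 1 < p) (hp5 : p < 5) (hc0 : 0 < c) (hc : c < 1 / 4)
    (m₀ B : ℝ) : ∃ Y, ∀ u : H10, mass u ≤ m₀ → energy p c u ≤ B → ‖der u‖ ≤ Y := by
  refine ⟨_, fun u hm hE => le_of_sq_le_add_rpow (κ := (1 - 4 * c) / 2) (B := max B 0)
    (K := 1 / (p + 1) * ((2 * √m₀) ^ ((p - 1) / 2) * m₀)) (q := (p - 1) / 2) (by linarith)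
    (le_max_right _ _) (by linarith) (by linarith) ?_⟩
  have h1 := le_energy (p := p) hc0 u
  have h2 := mul_le_mul_of_nonneg_left (potential_le_of_mass_le hp hm)
    (one_div_nonneg.2 (by linarith : 0 ≤ p + 1))
  rw [← mul_assoc] at h2
  linarith [le_max_left B 0]

lemma exists_le_energy {p c : ℝ} (hp : 1 < p) (hp5 : p < 5) (hc0 : 0 < c) (hc : c < 1 / 4)
    (m₀ : ℝ) : ∃ L, ∀ u : H10, mass u ≤ m₀ → L ≤ energy p c u := by
  obtain ⟨Y, hY⟩ := exists_norm_der_le hp hp5 hc0 hc m₀ 0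
  refine ⟨min 0 (-(1 / (p + 1) * ((2 * √m₀) ^ ((p - 1) / 2) * m₀ * Y ^ ((p - 1) / 2)))),
    fun u hm => ?_⟩
  rcases le_total (energy p c u) 0 with hE | hE
  swap
  · exact (min_le_left _ _).trans hE
  refine (min_le_right _ _).trans ?_
  have h1 := le_energy (p := p) hc0 u
  have h2 : potential p u ≤ (2 * √m₀) ^ ((p - 1) / 2) * m₀ * Y ^ ((p - 1) / 2) := by
    refine (potential_le_of_mass_le hp hm).trans ?_
    have h3 : 0 ≤ m₀ := (mass_nonneg u).trans hm
    have h4 := hY u hm hE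
    have h5 : 0 ≤ (p - 1) / 2 := by linarith
    gcongr
  have h3 := mul_le_mul_of_nonneg_left h2 (one_div_nonneg.2 (by linarith : 0 ≤ p + 1))
  nlinarith [sq_nonneg ‖der u‖]

lemma bddBelow_energy {p c : ℝ} (hp : 1 < p) (hp5 : p < 5) (hc0 : 0 < c) (hc : c < 1 / 4)
    (μ : ℝ) : BddBelow (energy p c '' sphere μ) := by
  obtain ⟨L, hL⟩ := exists_le_energy hp hp5 hc0 hc μ
  refine ⟨L, ?_⟩
  rintro _ ⟨u, hu, rfl⟩
  exact hL u (le_of_eq hu)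

/-- Scale `u` up to mass `μ` by `t = √(μ / mass u) ≥ 1` and use that the energy grows at most like
`t²`. At zero mass the potential term vanishes and the energy is nonnegative. -/
lemma div_mul_minEnergy_le {p c μ : ℝ} (hp : 1 < p) (hp5 : p < 5) (hc0 : 0 < c)
    (hc : c < 1 / 4) (hμ : 0 < μ) {u : H10} (hu : mass u ≤ μ) :
    mass u / μ * minEnergy p c μ ≤ energy p c u := by
  rcases (mass_nonneg u).eq_or_lt with h0 | h0
  · have h1 := potential_le hp u
    rw [← h0, mul_zero] at h1
    have h2 := le_energy (p := p) hc0 u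
    have h3 : potential p u = 0 := le_antisymm h1 (potential_nonneg p u)
    rw [← h0, zero_div, zero_mul]
    rw [h3] at h2
    nlinarith [sq_nonneg ‖der u‖]
  · have hr : 1 ≤ μ / mass u := (one_le_div h0).2 hu
    set t := √(μ / mass u) with ht
    have ht1 : 1 ≤ t := Real.one_le_sqrt.2 hr
    have ht2 : t ^ 2 = μ / mass u := Real.sq_sqrt (by linarith)
    have hmem : ((t : ℂ) • u) ∈ sphere μ := by
      change mass ((t : ℂ) • u) = μ
      rw [mass_smul, ht2, div_mul_cancel₀ _ h0.ne']
    have h1 : minEnergy p c μ ≤ energy p c ((t : ℂ) • u) :=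
      csInf_le (bddBelow_energy hp hp5 hc0 hc μ) ⟨_, hmem, rfl⟩
    have h2 := h1.trans (energy_smul_le hp ht1 u)
    rw [ht2] at h2
    rw [div_mul_eq_mul_div, div_le_iff₀ hμ]
    rw [div_mul_eq_mul_div, le_div_iff₀ h0] at h2
    linarith

/-! ### Compactness of minimizing sequences -/

theorem exists_tendsto_of_minimizing {p c μ : ℝ} (hp : 1 < p) (hp5 : p < 5) (hc0 : 0 < c)
    (hc : c < 1 / 4) (hμ : 0 < μ) (hlt : minEnergy p c μ < freeLevel p μ) {u : ℕ → H10}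
    (hmass : Tendsto (fun n => mass (u n)) atTop (𝓝 μ))
    (hE : Tendsto (fun n => energy p c (u n)) atTop (𝓝 (minEnergy p c μ))) :
    ∃ (k : ℕ → ℕ) (v : H10), StrictMono k ∧ v ∈ sphere μ ∧
      energy p c v = minEnergy p c μ ∧ Tendsto (fun n => u (k n)) atTop (𝓝 v) := by
  obtain ⟨m₀, hm₀⟩ := hmass.bddAbove_range
  obtain ⟨B, hB⟩ := hE.bddAbove_range
  obtain ⟨Y, hY⟩ := exists_norm_der_le hp hp5 hc0 hc m₀ B
  have hbd : ∀ n, ‖u n‖ ≤ √(m₀ + Y ^ 2) := fun n => by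
    have h1 : mass (u n) ≤ m₀ := hm₀ ⟨n, rfl⟩
    have h2 := pow_le_pow_left₀ (norm_nonneg _) (hY (u n) h1 (hB ⟨n, rfl⟩)) 2
    refine Real.le_sqrt_of_sq_le ?_
    rw [norm_sq_eq]
    linarith
  obtain ⟨k, hk, v, hv⟩ := exists_weakTendsto_subseq hbd
  have hC : ∀ n, ‖(u ∘ k) n - v‖ ≤ √(m₀ + Y ^ 2) + ‖v‖ := fun n =>
    (norm_sub_le _ _).trans (add_le_add_left (hbd (k n)) _)
  set w : ℕ → H10 := fun n => (u ∘ k) n - v with hw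
  have hw0 : WeakTendsto w 0 := hv.sub_self
  have hmw : Tendsto (fun n => mass (w n)) atTop (𝓝 (μ - mass v)) := by
    have h1 := ((hmass.comp hk.tendsto_atTop).sub_const (mass v)).sub (tendsto_mass_sub hC hv)
    rw [sub_zero] at h1
    refine h1.congr fun n => ?_
    simp only [Function.comp, hw]
    ring
  have hEw : Tendsto (fun n => energy p c (w n)) atTop
      (𝓝 (minEnergy p c μ - energy p c v)) := by
    have h1 := ((hE.comp hk.tendsto_atTop).sub_const (energy p c v)).sub
      (tendsto_energy_sub hC hv hp c)
    rw [sub_zero] at h1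
    refine h1.congr fun n => ?_
    simp only [Function.comp, hw]
    ring
  have hmv : mass v ≤ μ := sub_nonneg.1 (ge_of_tendsto' hmw fun n => mass_nonneg _)
  have hlow : (μ - mass v) / μ * freeLevel p μ ≤ minEnergy p c μ - energy p c v := by
    refine le_of_forall_pos_le_add fun ε hε => ?_
    have h1 := hw0.eventually_le_energy hp hp5 hc0 hc hμ
      (by linarith [mass_nonneg v] : μ - mass v ≤ μ) hC hmw hε
    have h2 := ge_of_tendsto hEw h1
    linarith
  have hv1 := div_mul_minEnergy_le hp hp5 hc0 hc hμ hmv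
  have hmv' : mass v = μ := by
    refine le_antisymm hmv ?_
    have h1 : (μ - mass v) / μ = 1 - mass v / μ := by field_simp
    rw [h1] at hlow
    -- The sum of the lower bounds for the remainder and for `v`; the strict gap then leaves no mass
    -- for the remainder.
    have h2 : (1 - mass v / μ) * (freeLevel p μ - minEnergy p c μ) ≤ 0 := by linarith
    have h3 : 1 - mass v / μ ≤ 0 := nonpos_of_mul_nonpos_left h2 (by linarith)
    have h4 : 1 ≤ mass v / μ := by linarith
    exact (one_le_div hμ).1 h4
  rw [hmv', sub_self] at hmw
  rw [hmv', div_self hμ.ne', one_mul] at hv1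
  -- The remainder is bounded in sup norm, so its potential term is controlled by its vanishing
  -- mass.
  have hpw : Tendsto (fun n => potential p (w n)) atTop (𝓝 0) := by
    have h1 : Tendsto (fun n => (2 * (√(m₀ + Y ^ 2) + ‖v‖)) ^ (p - 1) * mass (w n)) atTop
        (𝓝 0) := by simpa using hmw.const_mul _
    refine squeeze_zero (fun n => potential_nonneg p _) (fun n => ?_) h1
    exact potential_le_of_bound hp fun x hx =>
      (norm_rep_le _ hx).trans (mul_le_mul_of_nonneg_left (hC n) zero_le_two)
  have hsum : Tendsto (fun n => energy p c (w n) + 1 / (p + 1) * potential p (w n)) atTop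
      (𝓝 (minEnergy p c μ - energy p c v)) := by
    simpa using hEw.add (hpw.const_mul (1 / (p + 1)))
  have hkin : ∀ n, (1 - 4 * c) / 2 * ‖der (w n)‖ ^ 2 ≤
      energy p c (w n) + 1 / (p + 1) * potential p (w n) := fun n => by
    linarith [le_energy (p := p) hc0 (w n)]
  -- The limiting energy of the remainder is nonnegative by coercivity. Together with `hv1` it
  -- forces `v` to be a minimizer, and then the same coercivity drives the derivatives to zero.
  have hnn : 0 ≤ minEnergy p c μ - energy p c v :=
    ge_of_tendsto' hsum fun n => (mul_nonneg (by linarith) (sq_nonneg _)).trans (hkin n)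
  have hEv : energy p c v = minEnergy p c μ := le_antisymm (by linarith) hv1
  rw [hEv, sub_self] at hsum
  have hder : Tendsto (fun n => ‖der (w n)‖ ^ 2) atTop (𝓝 0) := by
    have h1 : Tendsto (fun n => 2 / (1 - 4 * c) *
        (energy p c (w n) + 1 / (p + 1) * potential p (w n))) atTop (𝓝 0) := by
      simpa using hsum.const_mul (2 / (1 - 4 * c))
    refine squeeze_zero (fun n => sq_nonneg _) (fun n => ?_) h1
    have h2 : 0 < 1 - 4 * c := by linarith
    rw [div_mul_eq_mul_div, le_div_iff₀ h2]
    linarith [hkin n]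
  refine ⟨k, v, hk, hmv', hEv, ?_⟩
  rw [tendsto_iff_norm_sub_tendsto_zero]
  have h1 : Tendsto (fun n => ‖w n‖ ^ 2) atTop (𝓝 0) := by
    simp_rw [norm_sq_eq]
    simpa using hmw.add hder
  have h2 := h1.sqrt
  simp only [Real.sqrt_sq (norm_nonneg _), Real.sqrt_zero] at h2
  exact h2

/-! ### The soliton on the whole line -/

section Soliton

/-- `tanh (κ y)`. -/
def tanhScaled (κ y : ℝ) : ℝ := Real.sinh (κ * y) / Real.cosh (κ * y)

lemma one_sub_tanhScaled_sq (κ y : ℝ) : 1 - tanhScaled κ y ^ 2 = (Real.cosh (κ * y) ^ 2)⁻¹ := by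
  have h := (Real.cosh_pos (κ * y)).ne'
  rw [tanhScaled, div_pow]
  field_simp
  linarith [Real.cosh_sq (κ * y)]

lemma tanhScaled_sq_le_one (κ y : ℝ) : tanhScaled κ y ^ 2 ≤ 1 := by
  have := one_sub_tanhScaled_sq κ y
  have h2 : 0 ≤ (Real.cosh (κ * y) ^ 2)⁻¹ := by positivity
  linarith

lemma abs_tanhScaled_le_one (κ y : ℝ) : |tanhScaled κ y| ≤ 1 :=
  (sq_le_one_iff_abs_le_one _).1 (tanhScaled_sq_le_one κ y)

lemma hasDerivAt_cosh_mul (κ y : ℝ) :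
    HasDerivAt (fun y => Real.cosh (κ * y)) (Real.sinh (κ * y) * κ) y := by
  simpa using ((hasDerivAt_id y).const_mul κ).cosh

lemma hasDerivAt_tanhScaled (κ y : ℝ) :
    HasDerivAt (tanhScaled κ) (κ * (1 - tanhScaled κ y ^ 2)) y := by
  have h1 : HasDerivAt (fun y => Real.sinh (κ * y)) (Real.cosh (κ * y) * κ) y := by
    simpa using ((hasDerivAt_id y).const_mul κ).sinh
  have h := (Real.cosh_pos (κ * y)).ne'
  refine (h1.div (hasDerivAt_cosh_mul κ y) h).congr_deriv ?_
  rw [tanhScaled]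
  field_simp

lemma continuous_tanhScaled (κ : ℝ) : Continuous (tanhScaled κ) :=
  continuous_iff_continuousAt.2 fun y => (hasDerivAt_tanhScaled κ y).continuousAt

/-- The function `M cosh(κ y)^(-a)`. -/
def soliton (M κ a y : ℝ) : ℝ := M * Real.cosh (κ * y) ^ (-a)

variable {M κ a : ℝ}

lemma soliton_pos (hM : 0 < M) (y : ℝ) : 0 < soliton M κ a y :=
  mul_pos hM (Real.rpow_pos_of_pos (Real.cosh_pos _) _)

lemma soliton_le (hM : 0 < M) (ha : 0 < a) (y : ℝ) : soliton M κ a y ≤ M := by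
  have := Real.rpow_le_one_of_one_le_of_nonpos (Real.one_le_cosh (κ * y)) (by linarith : -a ≤ 0)
  rw [soliton]
  nlinarith

lemma contDiff_soliton : ContDiff ℝ (⊤ : ℕ∞) (soliton M κ a) := by
  refine contDiff_const.mul (ContDiff.rpow_const_of_ne ?_ fun y => (Real.cosh_pos _).ne')
  exact Real.contDiff_cosh.comp (contDiff_const.mul contDiff_id)

lemma hasDerivAt_soliton (y : ℝ) :
    HasDerivAt (soliton M κ a) (-(a * κ) * tanhScaled κ y * soliton M κ a y) y := by
  have h0 := Real.cosh_pos (κ * y)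
  refine (((hasDerivAt_cosh_mul κ y).rpow_const (p := -a) (Or.inl h0.ne')).const_mul
    M).congr_deriv ?_
  rw [tanhScaled, soliton, Real.rpow_sub_one h0.ne']
  field_simp

lemma continuous_soliton : Continuous (soliton M κ a) := contDiff_soliton.continuous

lemma soliton_abs (y : ℝ) : soliton M κ a |y| = soliton M κ a y := by
  rcases abs_cases y with ⟨h, -⟩ | ⟨h, -⟩ <;> simp [soliton, h]

lemma tanhScaled_abs_sq (y : ℝ) : tanhScaled κ |y| ^ 2 = tanhScaled κ y ^ 2 := by
  rcases abs_cases y with ⟨h, -⟩ | ⟨h, -⟩ <;> simp [tanhScaled, h, neg_div]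

lemma soliton_le_exp (hM : 0 < M) (ha : 0 < a) (y : ℝ) :
    soliton M κ a y ≤ M * 2 ^ a * Real.exp (-(a * κ * |y|)) := by
  have h1 : Real.exp (κ * |y|) / 2 ≤ Real.cosh (κ * y) := by
    have h2 : Real.cosh (κ * y) = Real.cosh (κ * |y|) := by
      rcases abs_cases y with ⟨h, -⟩ | ⟨h, -⟩ <;> simp [h]
    rw [h2, Real.cosh_eq]
    linarith [Real.exp_pos (-(κ * |y|))]
  have h3 := Real.rpow_le_rpow_of_nonpos (by positivity) h1 (by linarith : -a ≤ 0)
  rw [soliton, mul_assoc]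
  refine mul_le_mul_of_nonneg_left (h3.trans (le_of_eq ?_)) hM.le
  rw [Real.div_rpow (Real.exp_pos _).le zero_le_two, ← Real.exp_mul, Real.rpow_neg zero_le_two,
    div_inv_eq_mul, mul_comm]
  ring_nf

/-- The fourth power of `t ≤ exp t` at `t = b (|y| + 3) / 4`. -/
lemma abs_add_three_pow_le {b : ℝ} (hb : 0 < b) (y : ℝ) :
    (|y| + 3) ^ 4 ≤ (4 / b) ^ 4 * Real.exp (3 * b) * Real.exp (b * |y|) := by
  have h1 : b / 4 * (|y| + 3) ≤ Real.exp (b / 4 * (|y| + 3)) := by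
    linarith [Real.add_one_le_exp (b / 4 * (|y| + 3))]
  have h2 := pow_le_pow_left₀ (by positivity) h1 4
  rw [← Real.exp_nat_mul, mul_pow] at h2
  have h3 : Real.exp (((4 : ℕ) : ℝ) * (b / 4 * (|y| + 3))) =
      Real.exp (3 * b) * Real.exp (b * |y|) := by
    rw [← Real.exp_add]
    congr 1
    push_cast
    ring
  rw [h3] at h2
  calc (|y| + 3) ^ 4 = (4 / b) ^ 4 * ((b / 4) ^ 4 * (|y| + 3) ^ 4) := by field_simp
    _ ≤ (4 / b) ^ 4 * (Real.exp (3 * b) * Real.exp (b * |y|)) := by gcongr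
    _ = _ := by ring

/-- The shift `3` fits the cutoff: `|y| ≥ R - 2` gives `|y| + 3 ≥ R + 1`, so tails of this integral
control `(R + 1)²` times the tail mass. The fourth-power bound leaves room for comparison with `1 /
(1 + y²)`. -/
lemma integrable_sq_mul_soliton_sq (hM : 0 < M) (ha : 0 < a) (hκ : 0 < κ) :
    Integrable (fun y => (|y| + 3) ^ 2 * soliton M κ a y ^ 2) := by
  set b := 2 * (a * κ) with hb
  have hb0 : 0 < b := by positivity
  refine (integrable_inv_one_add_sq.const_mul
    ((4 / b) ^ 4 * Real.exp (3 * b) * (M * 2 ^ a) ^ 2)).mono' ?_ (Eventually.of_forall fun y => ?_)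
  · have := continuous_soliton (M := M) (κ := κ) (a := a)
    exact Continuous.aestronglyMeasurable (by fun_prop)
  rw [Real.norm_of_nonneg (by positivity), ← div_eq_mul_inv, le_div_iff₀ (by positivity)]
  have h1 := pow_le_pow_left₀ (soliton_pos hM y).le (soliton_le_exp (κ := κ) hM ha y) 2
  rw [mul_pow, ← Real.exp_nat_mul] at h1
  have h2 : 1 + y ^ 2 ≤ (|y| + 3) ^ 2 := by nlinarith [abs_nonneg y, sq_abs y]
  have h3 : Real.exp (b * |y|) * Real.exp (((2 : ℕ) : ℝ) * -(a * κ * |y|)) = 1 := by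
    rw [← Real.exp_add, hb]
    push_cast
    ring_nf
    simp
  calc (|y| + 3) ^ 2 * soliton M κ a y ^ 2 * (1 + y ^ 2)
      ≤ (|y| + 3) ^ 2 * ((M * 2 ^ a) ^ 2 * Real.exp (((2 : ℕ) : ℝ) * -(a * κ * |y|))) *
          (|y| + 3) ^ 2 := by gcongr
    _ = (|y| + 3) ^ 4 * ((M * 2 ^ a) ^ 2 * Real.exp (((2 : ℕ) : ℝ) * -(a * κ * |y|))) := by ring
    _ ≤ (4 / b) ^ 4 * Real.exp (3 * b) * Real.exp (b * |y|) *
          ((M * 2 ^ a) ^ 2 * Real.exp (((2 : ℕ) : ℝ) * -(a * κ * |y|))) :=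
        mul_le_mul_of_nonneg_right (abs_add_three_pow_le hb0 y) (by positivity)
    _ = (4 / b) ^ 4 * Real.exp (3 * b) * (M * 2 ^ a) ^ 2 *
          (Real.exp (b * |y|) * Real.exp (((2 : ℕ) : ℝ) * -(a * κ * |y|))) := by ring
    _ = _ := by rw [h3, mul_one]

lemma integrable_mul_soliton_sq (hM : 0 < M) (ha : 0 < a) (hκ : 0 < κ) {f : ℝ → ℝ} {B : ℝ}
    (hf : Continuous f) (hB : ∀ y, |f y| ≤ B) :
    Integrable (fun y => f y * soliton M κ a y ^ 2) := by
  have hs := continuous_soliton (M := M) (κ := κ) (a := a)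
  refine ((integrable_sq_mul_soliton_sq hM ha hκ).const_mul B).mono'
    (Continuous.aestronglyMeasurable (by fun_prop)) (Eventually.of_forall fun y => ?_)
  rw [norm_mul, Real.norm_eq_abs, Real.norm_of_nonneg (sq_nonneg _)]
  refine mul_le_mul (hB y) ?_ (sq_nonneg _) ((abs_nonneg _).trans (hB y))
  have : 1 ≤ (|y| + 3) ^ 2 := by nlinarith [abs_nonneg y]
  nlinarith [sq_nonneg (soliton M κ a y)]

lemma integrable_soliton_sq (hM : 0 < M) (ha : 0 < a) (hκ : 0 < κ) :
    Integrable (fun y => soliton M κ a y ^ 2) := by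
  simpa using integrable_mul_soliton_sq hM ha hκ (f := fun _ => 1) (B := 1) (by fun_prop) (by simp)

lemma integrable_tanh_sq_mul_soliton_sq (hM : 0 < M) (ha : 0 < a) (hκ : 0 < κ) :
    Integrable (fun y => tanhScaled κ y ^ 2 * soliton M κ a y ^ 2) :=
  integrable_mul_soliton_sq hM ha hκ (B := 1) ((continuous_tanhScaled κ).pow 2) fun y => by
    rw [abs_of_nonneg (sq_nonneg _)]
    exact tanhScaled_sq_le_one κ y

/-- The derivative of `tanh(κ y) φ²` has zero integral over the line. -/
lemma soliton_virial (hM : 0 < M) (ha : 0 < a) (hκ : 0 < κ) :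
    (∫ y, soliton M κ a y ^ 2) =
      (1 + 2 * a) * ∫ y, tanhScaled κ y ^ 2 * soliton M κ a y ^ 2 := by
  have hi1 := integrable_soliton_sq (M := M) (κ := κ) (a := a) hM ha hκ
  have hi2 := integrable_tanh_sq_mul_soliton_sq (M := M) (κ := κ) (a := a) hM ha hκ
  have hd : ∀ y, HasDerivAt (fun y => tanhScaled κ y * soliton M κ a y ^ 2)
      (κ * (soliton M κ a y ^ 2 - (1 + 2 * a) * (tanhScaled κ y ^ 2 * soliton M κ a y ^ 2)))
      y := fun y => by
    refine ((hasDerivAt_tanhScaled κ y).mul ((hasDerivAt_soliton y).pow 2)).congr_deriv ?_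
    simp
    ring
  have h := integral_eq_zero_of_hasDerivAt_of_integrable hd
    ((hi1.sub (hi2.const_mul _)).const_mul κ)
    (integrable_mul_soliton_sq hM ha hκ (continuous_tanhScaled κ) (abs_tanhScaled_le_one κ))
  rw [integral_const_mul, integral_sub hi1 (hi2.const_mul _), integral_const_mul] at h
  have := (mul_eq_zero.1 h).resolve_left hκ.ne'
  linarith

lemma tendsto_soliton (hM : 0 < M) (ha : 0 < a) (hκ : 0 < κ) :
    Tendsto (soliton M κ a) atTop (𝓝 0) := by
  have h1 : Tendsto (fun y : ℝ => M * 2 ^ a * Real.exp (-(a * κ * y))) atTop (𝓝 0) := by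
    have h2 := (Real.tendsto_exp_neg_atTop_nhds_zero.comp
      (tendsto_id.const_mul_atTop (mul_pos ha hκ))).const_mul (M * 2 ^ a)
    rw [mul_zero] at h2
    exact h2
  refine squeeze_zero' (Eventually.of_forall fun y => (soliton_pos hM y).le) ?_ h1
  filter_upwards [eventually_ge_atTop 0] with y hy
  have := soliton_le_exp (κ := κ) hM ha y
  rwa [abs_of_nonneg hy] at this

/-- The relation `a (p - 1) = 2` turns `φ^(p-1)` into `M^(p-1) cosh^(-2)`, which equals `M^(p-1) (1
- tanh²)`. -/
lemma soliton_rpow {p : ℝ} (hM : 0 < M) (ha : a * (p - 1) = 2) (y : ℝ) :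
    soliton M κ a y ^ (p + 1) =
      M ^ (p - 1) * ((1 - tanhScaled κ y ^ 2) * soliton M κ a y ^ 2) := by
  have h0 := Real.cosh_pos (κ * y)
  have h1 : soliton M κ a y ^ (p - 1) = M ^ (p - 1) * (1 - tanhScaled κ y ^ 2) := by
    rw [soliton, Real.mul_rpow hM.le (Real.rpow_nonneg h0.le _), ← Real.rpow_mul h0.le, neg_mul, ha,
      one_sub_tanhScaled_sq, Real.rpow_neg h0.le, Real.rpow_two]
  rw [show p + 1 = (p - 1) + 2 by ring, Real.rpow_add (soliton_pos hM y), h1, Real.rpow_two]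
  ring

/-- The first integral of the soliton equation: the calibration inequality is an equality along this
profile. -/
lemma solitonSlope_soliton {p : ℝ} (hM : 0 < M) (ha : a * (p - 1) = 2) (hκ : 0 < κ) {y : ℝ}
    (hy : 0 ≤ y) :
    solitonSlope p (soliton M κ a y / M) = tanhScaled κ y * (soliton M κ a y / M) := by
  have hs := soliton_pos (κ := κ) (a := a) hM y
  have hT : 0 ≤ tanhScaled κ y :=
    div_nonneg (Real.sinh_nonneg_iff.2 (by positivity)) (Real.cosh_pos _).le
  have h1 : (soliton M κ a y / M) ^ 2 - |soliton M κ a y / M| ^ (p + 1) =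
      (tanhScaled κ y * (soliton M κ a y / M)) ^ 2 := by
    rw [abs_of_pos (by positivity), Real.div_rpow hs.le hM.le, soliton_rpow hM ha,
      show M ^ (p + 1) = M ^ (p - 1) * M ^ 2 by
        rw [show p + 1 = (p - 1) + 2 by ring, Real.rpow_add hM, Real.rpow_two]]
    have := Real.rpow_pos_of_pos hM (p - 1)
    field_simp
    ring
  rw [solitonSlope, h1, Real.sqrt_sq (by positivity)]

/-- The kinetic energy of the soliton, computed by integrating along its range. -/
lemma soliton_kinetic {p : ℝ} (hp : 1 < p) (hM : 0 < M) (ha0 : 0 < a) (ha : a * (p - 1) = 2)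
    (hκ : 0 < κ) :
    a * κ * ∫ y, tanhScaled κ y ^ 2 * soliton M κ a y ^ 2 = 2 * (M ^ 2 * solitonPrim p 1) := by
  -- On `y ≥ 0` the profile decreases from `M` to `0`, so the integrand has an antiderivative in
  -- terms of the profile alone; evenness supplies the factor `2`.
  have hd : ∀ y ∈ Ici (0 : ℝ), HasDerivAt (fun y => -(M ^ 2 * solitonPrim p (soliton M κ a y / M)))
      (a * κ * (tanhScaled κ y ^ 2 * soliton M κ a y ^ 2)) y := fun y hy => by
    refine ((((hasDerivAt_solitonPrim hp _).comp y
      ((hasDerivAt_soliton y).div_const M)).const_mul (M ^ 2)).neg).congr_deriv ?_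
    rw [solitonSlope_soliton hM ha hκ hy]
    field_simp
  have hlim : Tendsto (fun y => -(M ^ 2 * solitonPrim p (soliton M κ a y / M))) atTop
      (𝓝 (-(M ^ 2 * solitonPrim p (0 / M)))) :=
    (((hasDerivAt_solitonPrim hp (0 / M)).continuousAt.tendsto.comp
      ((tendsto_soliton hM ha0 hκ).div_const M)).const_mul _).neg
  have h1 := integral_Ioi_of_hasDerivAt_of_tendsto' hd
    ((integrable_tanh_sq_mul_soliton_sq hM ha0 hκ).const_mul (a * κ)).integrableOn hlim
  have h2 := integral_comp_abs (f := fun y => tanhScaled κ y ^ 2 * soliton M κ a y ^ 2)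
  simp only [tanhScaled_abs_sq, soliton_abs] at h2
  rw [h2, mul_left_comm, ← integral_const_mul, h1]
  have h3 : soliton M κ a 0 = M := by simp [soliton]
  rw [h3, div_self hM.ne', zero_div, solitonPrim_zero]
  ring

end Soliton

/-- The soliton of mass `μ` realizes the energy level `freeLevel p μ`. -/
theorem exists_soliton {p μ : ℝ} (hp : 1 < p) (hp5 : p < 5) (hμ : 0 < μ) :
    ∃ (φ : ℝ → ℝ) (M B : ℝ), ContDiff ℝ (⊤ : ℕ∞) φ ∧ (∀ y, 0 < φ y) ∧ (∀ y, φ y ≤ M) ∧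
      (∀ y, |deriv φ y| ≤ B * φ y) ∧ Integrable (fun y => (|y| + 3) ^ 2 * φ y ^ 2) ∧
      ∫ y, φ y ^ 2 = μ ∧
      1 / 2 * (∫ y, deriv φ y ^ 2) - 1 / (p + 1) * (∫ y, φ y ^ (p + 1)) = freeLevel p μ := by
  set ω := optFreq p μ with hωdef
  have hω : 0 < ω := optFreq_pos hp hp5 hμ
  have hp1 : 0 < p - 1 := by linarith
  have hp2 : 0 < p + 1 := by linarith
  -- The amplitude inverts `ω = 2 M^(p-1) / (p+1)`, and below `κ` is fixed by the decay rate `a κ =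
  -- √ω`.
  set M : ℝ := ((p + 1) * ω / 2) ^ (1 / (p - 1)) with hMdef
  have hM : 0 < M := Real.rpow_pos_of_pos (by positivity) _
  have hMp : M ^ (p - 1) = (p + 1) * ω / 2 := by
    rw [hMdef, ← Real.rpow_mul (by positivity), one_div_mul_cancel hp1.ne', Real.rpow_one]
  set a : ℝ := 2 / (p - 1) with ha
  have ha0 : 0 < a := by positivity
  have hap : a * (p - 1) = 2 := div_mul_cancel₀ _ hp1.ne'
  set κ : ℝ := √ω / a with hκdef
  have hsω : 0 < √ω := Real.sqrt_pos.2 hω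
  have hκ : 0 < κ := by positivity
  have haκ : a * κ = √ω := mul_div_cancel₀ _ ha0.ne'
  set S := ∫ y, tanhScaled κ y ^ 2 * soliton M κ a y ^ 2 with hS
  have hi1 := integrable_soliton_sq (M := M) (κ := κ) (a := a) hM ha0 hκ
  have hi2 := integrable_tanh_sq_mul_soliton_sq (M := M) (κ := κ) (a := a) hM ha0 hκ
  have hvir := soliton_virial (M := M) (κ := κ) (a := a) hM ha0 hκ
  have hsq : √ω * √ω = ω := Real.mul_self_sqrt hω.le
  have hkin : ω * S = actionConst p * ω ^ actionExp p := by
    have h1 := soliton_kinetic (M := M) (κ := κ) (a := a) hp hM ha0 hap hκ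
    rw [← two_mul_sqrt_mul_sq_mul_solitonPrim hp hM (by rw [hMp]; field_simp)]
    rw [haκ] at h1
    linear_combination √ω * h1 - S * hsq
  have hlev := actionConst_mul_optFreq_rpow hp hp5 hμ
  have hexp : 2 * actionExp p = 1 + 2 * a := by
    rw [actionExp, ha]
    ring
  -- Since `2α = 1 + 2a`, the virial identity matches the stationarity condition defining `optFreq`.
  have hmass : ∫ y, soliton M κ a y ^ 2 = μ := by
    rw [hvir]
    rw [← hωdef, ← hkin, hexp] at hlev
    exact mul_left_cancel₀ hω.ne' (by linarith)
  refine ⟨soliton M κ a, M, √ω, contDiff_soliton, soliton_pos hM, soliton_le hM ha0, fun y => ?_,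
    integrable_sq_mul_soliton_sq hM ha0 hκ, hmass, ?_⟩
  · rw [(hasDerivAt_soliton y).deriv, haκ, abs_mul, abs_mul, abs_neg, abs_of_pos hsω,
      abs_of_pos (soliton_pos hM y), mul_assoc]
    refine mul_le_mul_of_nonneg_left ?_ hsω.le
    nlinarith [abs_tanhScaled_le_one κ y, soliton_pos (κ := κ) (a := a) hM y]
  · have h1 : ∫ y, deriv (soliton M κ a) y ^ 2 = ω * S := by
      rw [hS, ← integral_const_mul]
      refine integral_congr_ae (Eventually.of_forall fun y => ?_)
      simp only [(hasDerivAt_soliton (M := M) (κ := κ) (a := a) y).deriv, haκ]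
      linear_combination tanhScaled κ y ^ 2 * soliton M κ a y ^ 2 * hsq
    have h2 : ∫ y, soliton M κ a y ^ (p + 1) = (p + 1) * ω / 2 * (μ - S) := by
      simp_rw [soliton_rpow hM hap, sub_mul, one_mul]
      rw [integral_const_mul, integral_sub hi1 hi2, hmass, hMp]
    rw [h1, h2, freeLevel, ← hωdef, ← hkin]
    field_simp
    ring

/-! ### Trial functions -/

lemma setIntegral_Ioi_eq_integral {f : ℝ → ℝ} (hf : ∀ x, x ≤ 0 → f x = 0) :
    ∫ x in Ioi (0 : ℝ), f x = ∫ x, f x :=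
  setIntegral_eq_integral_of_forall_compl_eq_zero fun x hx => hf x (not_lt.1 hx)

/-- A nonnegative real test function as an element of `H¹₀(ℝ⁺)`, and its functionals. -/
lemma exists_H10_of_real {ψ : ℝ → ℝ} (hψ : ContDiff ℝ (⊤ : ℕ∞) ψ) (hc : HasCompactSupport ψ)
    (hs : tsupport ψ ⊆ Ioi 0) (h0 : ∀ x, 0 ≤ ψ x) :
    ∃ u : H10, mass u = ∫ x, ψ x ^ 2 ∧ ‖der u‖ ^ 2 = ∫ x, deriv ψ x ^ 2 ∧
      hardyIntegral u = ∫ x, ψ x ^ 2 / x ^ 2 ∧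
      ∀ p, 1 < p → potential p u = ∫ x, ψ x ^ (p + 1) := by
  have hd : ∀ x, HasDerivAt (fun x => (ψ x : ℂ)) ((deriv ψ x : ℝ) : ℂ) x := fun x =>
    ((hψ.differentiable (by simp)) x).hasDerivAt.ofReal_comp
  have htest : IsTestFunction fun x => (ψ x : ℂ) := by
    refine ⟨Complex.ofRealCLM.contDiff.comp hψ, ?_, ?_⟩
    · exact hc.comp_left (g := fun y : ℝ => (y : ℂ)) Complex.ofReal_zero
    · refine (closure_mono fun x hx => ?_).trans hs
      rw [Function.mem_support] at hx ⊢
      exact fun h => hx (by rw [h, Complex.ofReal_zero])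
  obtain ⟨u, hu, hu'⟩ := htest.exists_H10
  have hz : ∀ x, x ≤ 0 → ψ x = 0 := fun x hx => by
    by_contra h
    exact not_lt.2 hx (mem_Ioi.1 (hs (subset_tsupport ψ h)))
  have hz' : ∀ x, x ≤ 0 → deriv ψ x = 0 := fun x hx => by
    by_contra h
    exact not_lt.2 hx (mem_Ioi.1 (hs (tsupport_deriv_subset (f := ψ) (subset_tsupport _ h))))
  refine ⟨u, ?_, ?_, ?_, fun p hp => ?_⟩
  · rw [mass_eq_integral, ← setIntegral_Ioi_eq_integral fun x hx => by rw [hz x hx]; simp]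
    refine integral_congr_ae (hu.mono fun x hx => ?_)
    simp only [hx, Complex.norm_real, Real.norm_eq_abs, sq_abs]
  · rw [norm_sq_eq_integral, ← setIntegral_Ioi_eq_integral fun x hx => by rw [hz' x hx]; simp]
    refine integral_congr_ae (hu'.mono fun x hx => ?_)
    simp only [hx, (hd x).deriv, Complex.norm_real, Real.norm_eq_abs, sq_abs]
  · rw [hardyIntegral, ← setIntegral_Ioi_eq_integral fun x hx => by rw [hz x hx]; simp]
    refine integral_congr_ae (hu.mono fun x hx => ?_)
    simp only [hx, Complex.norm_real, Real.norm_eq_abs, sq_abs]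
  · rw [potential, ← setIntegral_Ioi_eq_integral fun x hx => by
      rw [hz x hx, Real.zero_rpow (by linarith)]]
    refine integral_congr_ae (hu.mono fun x hx => ?_)
    simp only [hx, Complex.norm_real, Real.norm_of_nonneg (h0 x)]

lemma exists_deriv_smoothTransition_le :
    ∃ L : ℝ, 0 ≤ L ∧ ∀ x, |deriv Real.smoothTransition x| ≤ L := by
  have hc : Continuous (deriv Real.smoothTransition) :=
    (Real.smoothTransition.contDiff (n := 1)).continuous_deriv le_rfl
  obtain ⟨L, hL⟩ := (isCompact_Icc (a := (0 : ℝ)) (b := 1)).exists_bound_of_continuousOn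
    hc.continuousOn
  have hL0 : 0 ≤ L := (norm_nonneg _).trans (hL 0 (by simp))
  refine ⟨L, hL0, fun x => ?_⟩
  by_cases hx : x ∈ Icc (0 : ℝ) 1
  · exact hL x hx
  have hz : deriv Real.smoothTransition x = 0 := by
    rw [mem_Icc, not_and_or, not_le, not_le] at hx
    rcases hx with hx | hx
    · have h1 : Real.smoothTransition =ᶠ[𝓝 x] fun _ => 0 := by
        filter_upwards [Iio_mem_nhds hx] with y hy
        exact Real.smoothTransition.zero_of_nonpos (le_of_lt hy)
      rw [h1.deriv_eq, deriv_const]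
    · have h1 : Real.smoothTransition =ᶠ[𝓝 x] fun _ => 1 := by
        filter_upwards [Ioi_mem_nhds hx] with y hy
        exact Real.smoothTransition.one_of_one_le (le_of_lt hy)
      rw [h1.deriv_eq, deriv_const]
  rw [hz, abs_zero]
  exact hL0

/-- A smooth cutoff of `[-R + 1, R - 1]`, equal to `1` on `[-R + 2, R - 2]`. -/
def cutoff (R y : ℝ) : ℝ :=
  Real.smoothTransition (R - 1 + y) * Real.smoothTransition (R - 1 - y)

lemma contDiff_cutoff (R : ℝ) : ContDiff ℝ (⊤ : ℕ∞) (cutoff R) :=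
  (Real.smoothTransition.contDiff.comp (contDiff_const.add contDiff_id)).mul
    (Real.smoothTransition.contDiff.comp (contDiff_const.sub contDiff_id))

lemma cutoff_nonneg (R y : ℝ) : 0 ≤ cutoff R y :=
  mul_nonneg (Real.smoothTransition.nonneg _) (Real.smoothTransition.nonneg _)

lemma cutoff_le_one (R y : ℝ) : cutoff R y ≤ 1 :=
  mul_le_one₀ (Real.smoothTransition.le_one _) (Real.smoothTransition.nonneg _)
    (Real.smoothTransition.le_one _)

lemma cutoff_eq_one {R y : ℝ} (h : |y| ≤ R - 2) : cutoff R y = 1 := by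
  obtain ⟨h1, h2⟩ := abs_le.1 h
  rw [cutoff, Real.smoothTransition.one_of_one_le (by linarith),
    Real.smoothTransition.one_of_one_le (by linarith), mul_one]

lemma cutoff_eq_zero {R y : ℝ} (h : R - 1 ≤ |y|) : cutoff R y = 0 := by
  rw [cutoff]
  rcases le_abs.1 h with h1 | h1
  · rw [Real.smoothTransition.zero_of_nonpos (x := R - 1 - y) (by linarith), mul_zero]
  · rw [Real.smoothTransition.zero_of_nonpos (x := R - 1 + y) (by linarith), zero_mul]

lemma abs_deriv_cutoff_le {L : ℝ} (hL : ∀ x, |deriv Real.smoothTransition x| ≤ L) (R y : ℝ) :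
    |deriv (cutoff R) y| ≤ 2 * L := by
  have hst : ∀ x, HasDerivAt Real.smoothTransition (deriv Real.smoothTransition x) x := fun x =>
    ((Real.smoothTransition.contDiff (n := 1)).differentiable one_ne_zero x).hasDerivAt
  have h1 := (hst (R - 1 + y)).comp y ((hasDerivAt_id y).const_add (R - 1))
  have h2 := (hst (R - 1 - y)).comp y ((hasDerivAt_id y).const_sub (R - 1))
  have h3 : HasDerivAt (cutoff R) _ y := h1.mul h2
  rw [h3.deriv]
  simp only [Function.comp, mul_one, mul_neg]
  have hL0 : 0 ≤ L := (abs_nonneg _).trans (hL 0)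
  refine (abs_add_le _ _).trans ?_
  rw [abs_mul, abs_neg, abs_mul]
  have e1 : |Real.smoothTransition (R - 1 - y)| ≤ 1 := by
    rw [abs_of_nonneg (Real.smoothTransition.nonneg _)]
    exact Real.smoothTransition.le_one _
  have e2 : |Real.smoothTransition (R - 1 + y)| ≤ 1 := by
    rw [abs_of_nonneg (Real.smoothTransition.nonneg _)]
    exact Real.smoothTransition.le_one _
  have e3 := mul_le_mul (hL (R - 1 + y)) e1 (abs_nonneg _) hL0
  have e4 := mul_le_mul e2 (hL (R - 1 - y)) (abs_nonneg _) zero_le_one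
  linarith

/-- The function `f` cut off to `{y | r ≤ |y|}`. -/
def tailPart (f : ℝ → ℝ) (r y : ℝ) : ℝ := {y : ℝ | r ≤ |y|}.indicator f y

lemma measurableSet_tail (r : ℝ) : MeasurableSet {y : ℝ | r ≤ |y|} :=
  measurableSet_le measurable_const measurable_id.abs

lemma integrable_tailPart {f : ℝ → ℝ} (hf : Integrable f) (r : ℝ) : Integrable (tailPart f r) :=
  hf.indicator (measurableSet_tail r)

lemma tendsto_integral_tailPart {f : ℝ → ℝ} (hf : Integrable f) :
    Tendsto (fun r => ∫ y, tailPart f r y) atTop (𝓝 0) := by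
  have h : Tendsto (fun r => ∫ y, tailPart f r y) atTop (𝓝 (∫ _ : ℝ, (0 : ℝ))) := by
    refine tendsto_integral_filter_of_dominated_convergence (fun y => ‖f y‖)
      (Eventually.of_forall fun r => (integrable_tailPart hf r).aestronglyMeasurable)
      (Eventually.of_forall fun r => Eventually.of_forall fun y => ?_) hf.norm
      (Eventually.of_forall fun y => ?_)
    · exact norm_indicator_le_norm_self _ _
    · refine tendsto_const_nhds.congr' ?_
      filter_upwards [eventually_gt_atTop |y|] with r hr
      exact (indicator_of_notMem (by simpa using hr) _).symm
  simpa using h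

section Trial

variable {φ : ℝ → ℝ} {M B L R : ℝ}

/-- The cutoff changes the profile only where `|y| ≥ R - 2`; there the product rule and `|φ'| ≤ B φ`
bound the new derivative by `(2L + B) φ`. -/
lemma sq_deriv_cutoff_mul_le (hφ : ContDiff ℝ (⊤ : ℕ∞) φ) (h0 : ∀ y, 0 < φ y)
    (hB : ∀ y, |deriv φ y| ≤ B * φ y) (hL : ∀ x, |deriv Real.smoothTransition x| ≤ L) (y : ℝ) :
    deriv (fun y => cutoff R y * φ y) y ^ 2 ≤
      deriv φ y ^ 2 + (2 * L + B) ^ 2 * tailPart (fun y => φ y ^ 2) (R - 2) y := by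
  have hL0 : 0 ≤ L := (abs_nonneg _).trans (hL 0)
  have hB0 : 0 ≤ B := by
    have := (abs_nonneg _).trans (hB 0)
    exact nonneg_of_mul_nonneg_left this (h0 0)
  by_cases hy : R - 2 ≤ |y|
  · rw [tailPart, indicator_of_mem (show y ∈ {y : ℝ | R - 2 ≤ |y|} from hy)]
    have hd : HasDerivAt (fun y => cutoff R y * φ y) _ y :=
      (((contDiff_cutoff R).differentiable (by simp)) y).hasDerivAt.mul
        ((hφ.differentiable (by simp)) y).hasDerivAt
    have h1 : |deriv (fun y => cutoff R y * φ y) y| ≤ (2 * L + B) * φ y := by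
      rw [hd.deriv]
      refine (abs_add_le _ _).trans ?_
      rw [abs_mul, abs_mul, abs_of_pos (h0 y), abs_of_nonneg (cutoff_nonneg R y)]
      have e1 := mul_le_mul_of_nonneg_right (abs_deriv_cutoff_le hL R y) (h0 y).le
      have e2 := mul_le_mul (cutoff_le_one R y) (hB y) (abs_nonneg _) zero_le_one
      linarith
    have h2 := pow_le_pow_left₀ (abs_nonneg _) h1 2
    rw [sq_abs, mul_pow] at h2
    linarith [sq_nonneg (deriv φ y)]
  · rw [tailPart, indicator_of_notMem (show y ∉ {y : ℝ | R - 2 ≤ |y|} from hy), mul_zero, add_zero]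
    have h1 : (fun y => cutoff R y * φ y) =ᶠ[𝓝 y] φ := by
      have : ∀ᶠ z in 𝓝 y, |z| < R - 2 :=
        continuous_abs.continuousAt.eventually_lt continuousAt_const (not_le.1 hy)
      filter_upwards [this] with z hz
      rw [cutoff_eq_one hz.le, one_mul]
    rw [h1.deriv_eq]

lemma le_cutoff_mul_rpow {p : ℝ} (hp : 1 < p) (h0 : ∀ y, 0 < φ y) (hM : ∀ y, φ y ≤ M) (y : ℝ) :
    φ y ^ (p + 1) - M ^ (p - 1) * tailPart (fun y => φ y ^ 2) (R - 2) y ≤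
      (cutoff R y * φ y) ^ (p + 1) := by
  by_cases hy : R - 2 ≤ |y|
  · rw [tailPart, indicator_of_mem (show y ∈ {y : ℝ | R - 2 ≤ |y|} from hy)]
    have h1 := rpow_add_one_le hp (h0 y).le (hM y)
    have h2 : 0 ≤ (cutoff R y * φ y) ^ (p + 1) :=
      Real.rpow_nonneg (mul_nonneg (cutoff_nonneg R y) (h0 y).le) _
    linarith
  · rw [tailPart, indicator_of_notMem (show y ∉ {y : ℝ | R - 2 ≤ |y|} from hy), mul_zero, sub_zero,
      cutoff_eq_one (not_le.1 hy).le, one_mul]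

/-- On the tail `R + 1 ≤ |y| + 3`. As the weighted tail tends to zero, the cutoff cost is
`o(R^(-2))`. -/
lemma sq_mul_integral_tailPart_le (hi : Integrable fun y => (|y| + 3) ^ 2 * φ y ^ 2)
    (hi2 : Integrable fun y => φ y ^ 2) (hR : 0 ≤ R) :
    (R + 1) ^ 2 * ∫ y, tailPart (fun y => φ y ^ 2) (R - 2) y ≤
      ∫ y, tailPart (fun y => (|y| + 3) ^ 2 * φ y ^ 2) (R - 2) y := by
  rw [← integral_const_mul]
  refine integral_mono ((integrable_tailPart hi2 _).const_mul _) (integrable_tailPart hi _)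
    fun y => ?_
  by_cases hy : R - 2 ≤ |y|
  · simp only [tailPart, indicator_of_mem (show y ∈ {y : ℝ | R - 2 ≤ |y|} from hy)]
    have : R + 1 ≤ |y| + 3 := by linarith
    gcongr
  · simp only [tailPart, indicator_of_notMem (show y ∉ {y : ℝ | R - 2 ≤ |y|} from hy), mul_zero,
      le_refl]

/-- Only the window `|x - R| ≤ 1` is retained: there `x ≤ R + 1`, and `R ≥ 3` makes the cutoff equal
to `1`. -/
lemma indicator_div_le_cutoff_mul_sq_div (hR : 3 ≤ R) (x : ℝ) :
    (Icc (-1 : ℝ) 1).indicator (fun y => 1 / (R + 1) ^ 2 * φ y ^ 2) (x - R) ≤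
      (cutoff R (x - R) * φ (x - R)) ^ 2 / x ^ 2 := by
  by_cases hx : x - R ∈ Icc (-1 : ℝ) 1
  · rw [indicator_of_mem hx, cutoff_eq_one ((abs_le.2 hx).trans (by linarith)), one_mul,
      div_mul_eq_mul_div, one_mul]
    have h1 : 0 < x := by linarith [hx.1]
    have h2 : x ≤ R + 1 := by linarith [hx.2]
    gcongr
  · rw [indicator_of_notMem hx]
    positivity

end Trial

/-- Far from the origin the attractive potential beats the cost of the cutoff. -/
theorem exists_energy_lt {p c M B : ℝ} (hp : 1 < p) (hc0 : 0 < c) {φ : ℝ → ℝ}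
    (hφ : ContDiff ℝ (⊤ : ℕ∞) φ) (h0 : ∀ y, 0 < φ y) (hM : ∀ y, φ y ≤ M)
    (hB : ∀ y, |deriv φ y| ≤ B * φ y) (hi : Integrable fun y => (|y| + 3) ^ 2 * φ y ^ 2) :
    ∃ u : H10, mass u ≤ ∫ y, φ y ^ 2 ∧ energy p c u <
      1 / 2 * (∫ y, deriv φ y ^ 2) - 1 / (p + 1) * (∫ y, φ y ^ (p + 1)) := by
  obtain ⟨L, hL0, hL⟩ := exists_deriv_smoothTransition_le
  have hp1 : 0 < p + 1 := by linarith
  have hM0 : 0 < M := (h0 0).trans_le (hM 0)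
  have hφc : Continuous φ := hφ.continuous
  have hi2 : Integrable fun y => φ y ^ 2 := by
    refine hi.mono' (hφc.pow 2).aestronglyMeasurable (Eventually.of_forall fun y => ?_)
    rw [Real.norm_of_nonneg (sq_nonneg _)]
    have : 1 ≤ (|y| + 3) ^ 2 := by nlinarith [abs_nonneg y]
    nlinarith [sq_nonneg (φ y)]
  have hi3 : Integrable fun y => deriv φ y ^ 2 := by
    refine (hi2.const_mul (B ^ 2)).mono'
      ((hφ.continuous_deriv (by simp)).pow 2).aestronglyMeasurable (Eventually.of_forall fun y => ?_)
    rw [Real.norm_of_nonneg (sq_nonneg _), ← mul_pow, ← sq_abs (deriv φ y)]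
    exact pow_le_pow_left₀ (abs_nonneg _) (hB y) 2
  have hi4 : Integrable fun y => φ y ^ (p + 1) := by
    refine (hi2.const_mul (M ^ (p - 1))).mono'
      (hφc.rpow_const fun y => Or.inr hp1.le).aestronglyMeasurable (Eventually.of_forall fun y => ?_)
    rw [Real.norm_of_nonneg (Real.rpow_nonneg (h0 y).le _)]
    exact rpow_add_one_le hp (h0 y).le (hM y)
  set c₀ := ∫ y, (Icc (-1 : ℝ) 1).indicator (fun y => φ y ^ 2) y with hc₀
  have hc₀pos : 0 < c₀ := by
    rw [hc₀, integral_indicator measurableSet_Icc, integral_Icc_eq_integral_Ioc,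
      ← intervalIntegral.integral_of_le (by norm_num)]
    exact intervalIntegral.intervalIntegral_pos_of_pos ((hφc.pow 2).intervalIntegrable _ _)
      (fun y => pow_pos (h0 y) 2) (by norm_num)
  -- The cost per unit of tail mass: the kinetic increase and the lost potential term.
  set K := 1 / 2 * (2 * L + B) ^ 2 + 1 / (p + 1) * M ^ (p - 1) with hK
  have hK0 : 0 ≤ K := by positivity
  obtain ⟨R, hR3, hR⟩ : ∃ R : ℝ, 3 ≤ R ∧
      K * ∫ y, tailPart (fun y => (|y| + 3) ^ 2 * φ y ^ 2) (R - 2) y < c / 2 * c₀ := by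
    have h1 := ((tendsto_integral_tailPart hi).comp
      (tendsto_atTop_add_const_right atTop (-2) tendsto_id)).const_mul K
    rw [mul_zero] at h1
    exact ((eventually_ge_atTop 3).and
      (h1.eventually_lt_const (show 0 < c / 2 * c₀ by positivity))).exists
  set χφ : ℝ → ℝ := fun y => cutoff R y * φ y with hχφ
  have hχs : ContDiff ℝ (⊤ : ℕ∞) χφ := (contDiff_cutoff R).mul hφ
  set ψ : ℝ → ℝ := fun x => χφ (x - R) with hψ
  have hψs : ContDiff ℝ (⊤ : ℕ∞) ψ := hχs.comp (contDiff_id.sub contDiff_const)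
  have hsub : tsupport ψ ⊆ Icc 1 (2 * R) := by
    refine closure_minimal (fun x hx => ?_) isClosed_Icc
    have h1 : ¬ R - 1 ≤ |x - R| := fun h => hx (by simp [hψ, hχφ, cutoff_eq_zero h])
    obtain ⟨h2, h3⟩ := abs_lt.1 (not_le.1 h1)
    exact ⟨by linarith, by linarith⟩
  have hψc : HasCompactSupport ψ := isCompact_Icc.of_isClosed_subset (isClosed_tsupport ψ) hsub
  have hψ0 : ∀ x, 0 ≤ ψ x := fun x => mul_nonneg (cutoff_nonneg _ _) (h0 _).le
  obtain ⟨u, hu1, hu2, hu3, hu4⟩ := exists_H10_of_real hψs hψc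
    (fun x hx => lt_of_lt_of_le one_pos (hsub hx).1) hψ0
  have hsq : ∀ x, ψ x ^ 2 ≤ φ (x - R) ^ 2 := fun x =>
    pow_le_pow_left₀ (hψ0 x) (mul_le_of_le_one_left (h0 _).le (cutoff_le_one _ _)) 2
  have hcs : ∀ f : ℝ → ℝ, Continuous f → (∀ x, ψ x = 0 → f x = 0) → Integrable f :=
    fun f hf h => hf.integrable_of_hasCompactSupport (hψc.mono' fun x hx =>
      subset_tsupport ψ fun h' => hx (h x h'))
  refine ⟨u, ?_, ?_⟩
  · rw [hu1, ← integral_sub_right_eq_self (fun y => φ y ^ 2) R]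
    refine integral_mono (hcs _ (hψs.continuous.pow 2) fun x hx => by rw [hx]; simp)
      (hi2.comp_sub_right R) hsq
  have hder : ‖der u‖ ^ 2 ≤ (∫ y, deriv φ y ^ 2) +
      (2 * L + B) ^ 2 * ∫ y, tailPart (fun y => φ y ^ 2) (R - 2) y := by
    have h1 : ∀ x, deriv ψ x = deriv χφ (x - R) := fun x => deriv_comp_sub_const χφ R x
    simp_rw [hu2, h1]
    rw [integral_sub_right_eq_self (fun y => deriv χφ y ^ 2) R, ← integral_const_mul,
      ← integral_add hi3 ((integrable_tailPart hi2 _).const_mul _)]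
    refine integral_mono_of_nonneg (Eventually.of_forall fun y => sq_nonneg _)
      (hi3.add ((integrable_tailPart hi2 _).const_mul _)) (Eventually.of_forall fun y => ?_)
    exact sq_deriv_cutoff_mul_le hφ h0 hB hL y
  have hpot : (∫ y, φ y ^ (p + 1)) - M ^ (p - 1) * ∫ y, tailPart (fun y => φ y ^ 2) (R - 2) y ≤
      potential p u := by
    rw [hu4 p hp, ← integral_const_mul,
      ← integral_sub hi4 ((integrable_tailPart hi2 _).const_mul _),
      ← integral_sub_right_eq_self
        (fun y => φ y ^ (p + 1) - M ^ (p - 1) * tailPart (fun y => φ y ^ 2) (R - 2) y) R]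
    refine integral_mono ((hi4.sub ((integrable_tailPart hi2 _).const_mul _)).comp_sub_right R)
      (hcs _ (hψs.continuous.rpow_const fun x => Or.inr hp1.le) fun x hx => by
        rw [hx, Real.zero_rpow hp1.ne']) fun x => ?_
    exact le_cutoff_mul_rpow hp h0 hM (x - R)
  have hhar : c₀ / (R + 1) ^ 2 ≤ hardyIntegral u := by
    have h1 : c₀ / (R + 1) ^ 2 =
        ∫ x, (Icc (-1 : ℝ) 1).indicator (fun y => 1 / (R + 1) ^ 2 * φ y ^ 2) (x - R) := by
      rw [integral_sub_right_eq_self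
        (fun y => (Icc (-1 : ℝ) 1).indicator (fun y => 1 / (R + 1) ^ 2 * φ y ^ 2) y) R, hc₀,
        integral_indicator measurableSet_Icc, integral_indicator measurableSet_Icc,
        integral_const_mul]
      ring
    rw [hu3, h1]
    refine integral_mono_of_nonneg (Eventually.of_forall fun x => ?_) ?_
      (Eventually.of_forall fun x => indicator_div_le_cutoff_mul_sq_div hR3 x)
    · exact indicator_nonneg (fun y _ => by positivity) _
    -- Replacing `x` by `max x 1` makes the quotient continuous; nothing changes on the support of
    -- `ψ`, which lies in `[1, 2R]`.
    · have h2 : Continuous fun x => ψ x ^ 2 / (max x 1) ^ 2 :=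
        (hψs.continuous.pow 2).div (by fun_prop) fun x =>
          (pow_pos (lt_of_lt_of_le one_pos (le_max_right _ _)) 2).ne'
      refine (hcs _ h2 fun x hx => by rw [hx]; simp).congr (Eventually.of_forall fun x => ?_)
      by_cases hx : x ∈ tsupport ψ
      · simp only [max_eq_left (hsub hx).1]
      · have : ψ x = 0 := image_eq_zero_of_notMem_tsupport hx
        change ψ x ^ 2 / _ = ψ x ^ 2 / x ^ 2
        rw [this]
        simp
  have htail := sq_mul_integral_tailPart_le hi hi2 (by linarith : 0 ≤ R)
  set T := ∫ y, tailPart (fun y => φ y ^ 2) (R - 2) y with hT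
  have hKT : K * T < c / 2 * (c₀ / (R + 1) ^ 2) := by
    have hRpos : 0 < (R + 1) ^ 2 := by positivity
    rw [← mul_div_assoc, lt_div_iff₀ hRpos]
    nlinarith [mul_le_mul_of_nonneg_left htail hK0]
  have e1 := mul_le_mul_of_nonneg_left hpot (one_div_nonneg.2 hp1.le)
  have e2 := mul_le_mul_of_nonneg_left hhar (by positivity : 0 ≤ c / 2)
  have hKT' : K * T = 1 / 2 * (2 * L + B) ^ 2 * T + 1 / (p + 1) * (M ^ (p - 1) * T) := by
    rw [hK]
    ring
  rw [energy_eq, hardy_eq]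
  rw [mul_sub] at e1
  linarith

/-! ### The strict energy gap -/

section

variable {p c ω μ : ℝ}

lemma exists_mass_le_energy_lt (hp : 1 < p) (hp5 : p < 5) (hc0 : 0 < c) (hμ : 0 < μ) :
    ∃ u : H10, mass u ≤ μ ∧ energy p c u < freeLevel p μ := by
  obtain ⟨φ, M, B, h1, h2, h3, h4, h5, h6, h7⟩ := exists_soliton hp hp5 hμ
  obtain ⟨u, hu1, hu2⟩ := exists_energy_lt hp hc0 h1 h2 h3 h4 h5
  rw [h6] at hu1
  rw [h7] at hu2
  exact ⟨u, hu1, hu2⟩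

/-- The trial function may have lost mass. With `θ = mass u / μ ≤ 1`, `θ I ≤ E(u) < freeLevel < 0`
forces `I < 0`, and then `I ≤ θ I`. -/
lemma minEnergy_lt_freeLevel (hp : 1 < p) (hp5 : p < 5) (hc0 : 0 < c) (hc : c < 1 / 4)
    (hμ : 0 < μ) : minEnergy p c μ < freeLevel p μ := by
  obtain ⟨u, hu, hE⟩ := exists_mass_le_energy_lt hp hp5 hc0 hμ
  have h1 := div_mul_minEnergy_le hp hp5 hc0 hc hμ hu
  have h2 := freeLevel_neg hp hp5 hμ
  have h3 : mass u / μ ≤ 1 := (div_le_one hμ).2 hu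
  have h4 : 0 ≤ mass u / μ := div_nonneg (mass_nonneg u) hμ.le
  have h5 : minEnergy p c μ < 0 := by
    by_contra h
    nlinarith
  nlinarith

/-! ### Positivity of the mass of the ground states -/

lemma min_mul_norm_sq_le (hc0 : 0 < c) (u : H10) :
    min (1 - 4 * c) ω * ‖u‖ ^ 2 ≤ hardy c u + ω * mass u := by
  have h1 := le_hardy hc0 u
  have h2 := mul_le_mul_of_nonneg_right (min_le_left (1 - 4 * c) ω) (sq_nonneg ‖der u‖)
  have h3 := mul_le_mul_of_nonneg_right (min_le_right (1 - 4 * c) ω) (mass_nonneg u)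
  rw [norm_sq_eq]
  linarith

lemma action_eq_of_mem_nehari {u : H10} (hu : u ∈ nehari p c ω) :
    action p c ω u = (1 / 2 - 1 / (p + 1)) * (hardy c u + ω * mass u) := by
  have h : potential p u = hardy c u + ω * mass u := by linarith [hu.2]
  rw [action, h]
  ring

/-- On the Nehari manifold coercivity and the sup bound give `κ ‖u‖² ≤ (2‖u‖)^(p-1) ‖u‖²`. This
keeps `‖u‖` away from zero, and the action there is a positive multiple of the quadratic form. -/
lemma exists_pos_le_action (hp : 1 < p) (hc0 : 0 < c) (hc : c < 1 / 4) (hω : 0 < ω) :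
    ∃ δ > 0, ∀ u ∈ nehari p c ω, δ ≤ action p c ω u := by
  set κ := min (1 - 4 * c) ω with hκ
  have hκ0 : 0 < κ := lt_min (by linarith) hω
  set ρ := (κ / 2 ^ (p - 1)) ^ (1 / (p - 1)) with hρ
  have hp1 : 0 < p - 1 := by linarith
  have hρ0 : 0 < ρ := Real.rpow_pos_of_pos (by positivity) _
  have hcoef : 0 < 1 / 2 - 1 / (p + 1) := by
    rw [sub_pos]
    exact one_div_lt_one_div_of_lt two_pos (by linarith)
  refine ⟨(1 / 2 - 1 / (p + 1)) * (κ * ρ ^ 2), by positivity, fun u hu => ?_⟩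
  have hn : 0 < ‖u‖ := norm_pos_iff.2 hu.1
  have h1 := min_mul_norm_sq_le (ω := ω) hc0 u
  have h2 : potential p u ≤ (2 * ‖u‖) ^ (p - 1) * ‖u‖ ^ 2 :=
    (potential_le_of_bound hp fun x hx => norm_rep_le u hx).trans
      (mul_le_mul_of_nonneg_left (mass_le_norm_sq u) (by positivity))
  have h3 : κ ≤ (2 * ‖u‖) ^ (p - 1) := by
    have h4 : κ * ‖u‖ ^ 2 ≤ (2 * ‖u‖) ^ (p - 1) * ‖u‖ ^ 2 := by linarith [hu.2]
    exact le_of_mul_le_mul_right h4 (by positivity)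
  have h5 : ρ ≤ ‖u‖ := by
    rw [Real.mul_rpow zero_le_two hn.le, mul_comm, ← div_le_iff₀ (by positivity)] at h3
    have h6 := Real.rpow_le_rpow (by positivity) h3 (one_div_nonneg.2 hp1.le)
    rwa [← Real.rpow_mul hn.le, mul_one_div_cancel hp1.ne', Real.rpow_one] at h6
  rw [action_eq_of_mem_nehari hu]
  refine mul_le_mul_of_nonneg_left (le_trans ?_ h1) hcoef.le
  gcongr

/-- A function of negative energy has a positive potential term, and a suitable multiple lies on the
manifold. Nonemptiness matters for the level, because `sInf ∅ = 0`. -/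
lemma nehari_nonempty (hp : 1 < p) (hp5 : p < 5) (hc0 : 0 < c) (hc : c < 1 / 4) (hω : 0 < ω) :
    (nehari p c ω).Nonempty := by
  obtain ⟨u, -, hE⟩ := exists_mass_le_energy_lt (c := c) hp hp5 hc0 one_pos
  have hE0 := hE.trans (freeLevel_neg hp hp5 one_pos)
  have hP : 0 < potential p u := by
    have h1 := le_energy (p := p) hc0 u
    have h2 : 0 < 1 / (p + 1) * potential p u := by nlinarith [sq_nonneg ‖der u‖]
    exact pos_of_mul_pos_right h2 (one_div_nonneg.2 (by linarith))
  have hu : u ≠ 0 := by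
    rintro rfl
    have h := potential_le_of_bound hp fun x hx => norm_rep_le (0 : H10) hx
    have h0 : mass (0 : H10) = 0 := le_antisymm (by simpa using mass_le_norm_sq (0 : H10)) (mass_nonneg _)
    rw [h0, mul_zero] at h
    linarith
  have hQ : 0 < hardy c u + ω * mass u :=
    lt_of_lt_of_le (mul_pos (lt_min (by linarith) hω) (pow_pos (norm_pos_iff.2 hu) 2))
      (min_mul_norm_sq_le hc0 u)
  have hp1 : 0 < p - 1 := by linarith
  set t := ((hardy c u + ω * mass u) / potential p u) ^ (1 / (p - 1)) with ht
  have ht0 : 0 < t := Real.rpow_pos_of_pos (by positivity) _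
  have htp : t ^ (p - 1) = (hardy c u + ω * mass u) / potential p u := by
    rw [ht, ← Real.rpow_mul (by positivity), one_div_mul_cancel hp1.ne', Real.rpow_one]
  refine ⟨(t : ℂ) • u, smul_ne_zero (by exact_mod_cast ht0.ne') hu, ?_⟩
  rw [hardy_smul, mass_smul, potential_smul p ht0.le, show p + 1 = (p - 1) + 2 by ring,
    Real.rpow_add ht0, htp, Real.rpow_two]
  field_simp
  ring

lemma nehariLevel_pos (hp : 1 < p) (hp5 : p < 5) (hc0 : 0 < c) (hc : c < 1 / 4) (hω : 0 < ω) :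
    0 < nehariLevel p c ω := by
  obtain ⟨δ, hδ, h⟩ := exists_pos_le_action hp hc0 hc hω
  refine lt_of_lt_of_le hδ (le_csInf ((nehari_nonempty hp hp5 hc0 hc hω).image _) ?_)
  rintro _ ⟨u, hu, rfl⟩
  exact h u hu

/-- Test the equation against `u` itself: if the function component vanished, only `-‖u'‖²` would
remain, so `u` would be zero. -/
lemma mass_pos_of_mem_boundStates {u : H10} (hu : u ∈ boundStates p c ω) : 0 < mass u := by
  refine (mass_nonneg u).lt_of_ne fun h => hu.1 ?_
  have h0 : fn u = 0 := by
    have : ‖fn u‖ ^ 2 = 0 := h.symm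
    exact norm_eq_zero.1 (pow_eq_zero_iff two_ne_zero |>.1 this)
  have hae : ∀ᵐ x ∂(volume.restrict (Ioi (0 : ℝ))), fn u x = 0 := by
    rw [h0]
    exact Lp.coeFn_zero ℂ 2 (volume.restrict (Ioi (0 : ℝ)))
  have heq := hu.2 u
  rw [integral_eq_zero_of_ae (f := fun x => fn u x * conj (fn u x) / (x : ℂ) ^ 2)
      (hae.mono fun x hx => by simp [hx]),
    integral_eq_zero_of_ae (f := fun x => fn u x * conj (fn u x))
      (hae.mono fun x hx => by simp [hx]),
    integral_eq_zero_of_ae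
      (f := fun x => ((‖fn u x‖ ^ (p - 1) : ℝ) : ℂ) * fn u x * conj (fn u x))
      (hae.mono fun x hx => by simp [hx])] at heq
  have hd : ∫ x in Ioi (0 : ℝ), der u x * conj (der u x) = ((‖der u‖ ^ 2 : ℝ) : ℂ) := by
    rw [norm_sq_eq_integral, ← integral_complex_ofReal]
    refine integral_congr_ae (Eventually.of_forall fun x => ?_)
    simp only [Complex.mul_conj, Complex.normSq_eq_norm_sq]
  rw [hd] at heq
  have hd0 : ‖der u‖ ^ 2 = 0 := by
    have : -(((‖der u‖ ^ 2 : ℝ) : ℂ)) = 0 := by simpa using heq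
    exact_mod_cast neg_eq_zero.1 this
  have hn : ‖u‖ ^ 2 = 0 := by rw [norm_sq_eq, ← h, hd0, add_zero]
  exact norm_eq_zero.1 (pow_eq_zero_iff two_ne_zero |>.1 hn)

lemma IsGroundStateMass.pos (hp : 1 < p) (hp5 : p < 5) (hc0 : 0 < c) (hc : c < 1 / 4)
    (hω : 0 < ω) (h : IsGroundStateMass p c ω μ) : 0 < μ := by
  rcases h with h | ⟨u, hu, rfl⟩
  · rw [h]
    exact mul_pos (div_pos (nehariLevel_pos hp hp5 hc0 hc hω) hω)
      (div_pos (by linarith) (by linarith))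
  · exact mass_pos_of_mem_boundStates hu.1

end

end HalfLineNLS

end

/-! ### Attainment of the infimum and the main theorem -/

theorem mainTheorem3 (p c ω μ : ℝ) (hp : 1 < p) (hp5 : p < 5) (hc0 : 0 < c) (hc : c < 1 / 4)
    (hω : 0 < ω) (hμ : HalfLineNLS.IsGroundStateMass p c ω μ) :
    BddBelow (HalfLineNLS.energy p c '' HalfLineNLS.sphere μ) ∧
    HalfLineNLS.minEnergy p c μ < 0 ∧
    (∃ u ∈ HalfLineNLS.sphere μ, HalfLineNLS.energy p c u = HalfLineNLS.minEnergy p c μ) ∧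
    (∀ u : ℕ → HalfLineNLS.H10,
      Tendsto (fun n => HalfLineNLS.mass (u n)) atTop (𝓝 μ) →
      Tendsto (fun n => HalfLineNLS.energy p c (u n)) atTop (𝓝 (HalfLineNLS.minEnergy p c μ)) →
      ∃ (k : ℕ → ℕ) (v : HalfLineNLS.H10), StrictMono k ∧
        v ∈ HalfLineNLS.sphere μ ∧
        HalfLineNLS.energy p c v = HalfLineNLS.minEnergy p c μ ∧
        Tendsto (fun n => u (k n)) atTop (𝓝 v)) := by
  have hμ0 : 0 < μ := hμ.pos hp hp5 hc0 hc hω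
  have hlt := HalfLineNLS.minEnergy_lt_freeLevel hp hp5 hc0 hc hμ0
  have hneg := hlt.trans (HalfLineNLS.freeLevel_neg hp hp5 hμ0)
  have hbdd := HalfLineNLS.bddBelow_energy hp hp5 hc0 hc μ
  refine ⟨hbdd, hneg, ?_, fun u hmass hE =>
    HalfLineNLS.exists_tendsto_of_minimizing hp hp5 hc0 hc hμ0 hlt hmass hE⟩
  -- An empty sphere would give the default value `sInf ∅ = 0`, contradicting the negativity of the
  -- infimum.
  have hne : (HalfLineNLS.energy p c '' HalfLineNLS.sphere μ).Nonempty := by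
    by_contra h
    rw [HalfLineNLS.minEnergy, not_nonempty_iff_eq_empty.1 h, Real.sInf_empty] at hneg
    exact lt_irrefl _ hneg
  obtain ⟨e, -, he, hmem⟩ := exists_seq_tendsto_sInf hne hbdd
  choose u hu hue using hmem
  have hmass : Tendsto (fun n => HalfLineNLS.mass (u n)) atTop (𝓝 μ) :=
    tendsto_const_nhds.congr fun n => (hu n).symm
  obtain ⟨_, v, -, hv, hvE, -⟩ := HalfLineNLS.exists_tendsto_of_minimizing hp hp5 hc0 hc hμ0 hlt
    hmass (he.congr fun n => (hue n).symm)
  exact ⟨v, hv, hvE⟩
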